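/- **Setting.** Let $M$ be a geodesic metric space (any two points $x,y$ are joined by a path in $M$ that a unit-speed server traverses in time $d(x,y)$), $o\in M$ an origin, and $c\in\{1,2,\dots\}\cup\{\infty\}$ a capacity. In the *preemptive open online dial-a-ride problem*, a finite sequence $\sigma$ of requests $(a,b;t)$ with $a,b\in M$ and $t\ge 0$ is revealed over time, each at its release time $t$. A server starts in $o$ at time $0$ and moves in $M$ with at most unit speed. It may load a request at its starting position $a$ at any time from $t$ on, may unload a loaded request at any point and load it there again later, and never has more than $c$ requests on board; the request is served when it is unloaded at $b$. The server may finish anywhere. $\mathrm{Opt}(\sigma)$ is the infimum of the completion times of offline solutions, i.e. of the times at which all requests are served, and $\mathrm{Opt}(t)$ is the same for the requests released not later than $t$. A deterministic online algorithm is $\rho$-competitive if it serves every $\sigma$ completely by time $\rho\cdot\mathrm{Opt}(\sigma)$. The competitive ratio of an algorithm is the infimum of all $\rho\ge1$ for which it is $\rho$-competitive, and that of the problem is the infimum of all $\rho\ge 1$ for which there is some $\rho$-competitive deterministic online algorithm. **Algorithm** $\textsc{Lazy}(\alpha)$. *Upon receiving a request* at time $t$: if the server can finish serving all requests that it has loaded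 before (those on board and those it has temporarily unloaded), touching no other request, and return to $o$ until time $\alpha\cdot\mathrm{Opt}(t)$, then it aborts its current command and does so in the fastest possible way; otherwise it continues its current command. *Whenever it is idle* at time $t$: if $t<\alpha\cdot\mathrm{Opt}(t)$, it waits until time $\alpha\cdot\mathrm{Opt}(t)$; otherwise, if the set $R$ of released and unserved requests is non-empty, it follows a shortest preemptive schedule $S(R,p)$ that serves $R$ from its current position $p$. A *choice of optimal sub-schedules* is a rule that selects a shortest schedule $S(R,p)$ and a fastest way to deliver and return whenever they are needed. **Statement.** Let $c\in\{1,2,\dots\}\cup\{\infty\}$. a) For every geodesic metric space $M$ and every origin $o\in M$, the competitive ratio of the preemptive open online dial-a-ride problem on $M$ with capacity $c$ is at most $\frac32+\sqrt{\frac{11}{12}}\approx 2.457$. Moreover, for every choice of optimal sub-schedules, $\textsc{Lazy}\bigl(\frac12+\sqrt{\frac{11}{12}}\bigr)$ is a deterministic online algorithm for this problem of competitive ratio at most $\frac32+\sqrt{\frac{11}{12}}$. b) On the half-line $M=\mathbb R_{\ge0}$ with origin $o=0$, the competitive ratio of the preemptive open online dial-a-ride problem with capacity $c$ is at most $1+\frac{1+\sqrt3}{2}\approx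 2.366$. Moreover, a choice of optimal sub-schedules exists, and for every such choice $\textsc{Lazy}\bigl(\frac{1+\sqrt3}{2}\bigr)$ is a deterministic online algorithm for this problem of competitive ratio at most $1+\frac{1+\sqrt3}{2}$. -/

import Mathlib

open scoped NNReal ENNReal

noncomputable section

namespace DialARide

/-- Any two points are joined by a shortest path, i.e. a path that a server of unit speed traverses
in time equal to the distance of its end points. -/
def GeodesicSpace (M : Type*) [MetricSpace M] : Prop :=
  ∀ x y : M, ∃ γ : ℝ → M, γ 0 = x ∧ γ (dist x y) = y ∧
    ∀ s ∈ Set.Icc 0 (dist x y), ∀ t ∈ Set.Icc 0 (dist x y), dist (γ s) (γ t) = |s - t|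

/-- A transportation request `(a, b; t)`. -/
structure Request (M : Type*) where
  src : M
  dst : M
  release : ℝ≥0

/-- A request sequence lists the requests in the order of their release times. -/
def IsRequestSequence {M : Type*} (σ : List (Request M)) : Prop :=
  σ.Pairwise fun r r' => r.release ≤ r'.release

/-- The requests released not later than time `t`. For a request sequence this is an initial
segment, so requests keep their index. -/
def known {M : Type*} (σ : List (Request M)) (t : ℝ) : List (Request M) :=
  σ.filter fun r => (r.release : ℝ) ≤ t

/-- Where a request currently is: never loaded so far (hence at its starting position), on board of
the server, preemptively unloaded at `x`, or unloaded at its destination (served). -/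
inductive Status (M : Type*) where
  | waiting : Status M
  | carried : Status M
  | parked (x : M) : Status M
  | delivered : Status M

/-- The point at which a request with the given status can be loaded, if there is one. -/
def Status.spot {M : Type*} (r : Request M) : Status M → Option M
  | .waiting => some r.src
  | .carried => none
  | .parked x => some x
  | .delivered => none

/-- At time `time` the server loads (`isLoad = true`) or unloads (`isLoad = false`) the request with
index `idx`. -/
structure Event where
  time : ℝ
  idx : ℕ
  isLoad : Bool

open Classical in
/-- Effect of an event on the statuses. In the preemptive problem a request may be unloaded at any
point; it is served when it is unloaded at its destination. -/
def Event.apply {M : Type*} (σ : List (Request M)) (path : ℝ → M) (st : ℕ → Status M)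
    (e : Event) : ℕ → Status M :=
  Function.update st e.idx
    (if e.isLoad = true then .carried
     else if ∃ r, σ[e.idx]? = some r ∧ path e.time = r.dst then .delivered
     else .parked (path e.time))

/-- The statuses after a list of events. -/
def statusAfter {M : Type*} (σ : List (Request M)) (path : ℝ → M) (es : List Event)
    (st : ℕ → Status M) : ℕ → Status M :=
  es.foldl (fun st e => e.apply σ path st) st

/-- A request is loaded where it lies, and only if fewer than `c` requests are on board; it can be
unloaded if it is on board. -/
def Event.Legal {M : Type*} (σ : List (Request M)) (c : ℕ∞) (path : ℝ → M) (st : ℕ → Status M)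
    (e : Event) : Prop :=
  ∃ r, σ[e.idx]? = some r ∧
    (e.isLoad = true →
      (st e.idx).spot r = some (path e.time) ∧ {j | st j = .carried}.encard < c) ∧
    (e.isLoad = false → st e.idx = .carried)

/-- Each event of the list is legal when its turn comes. -/
def LegalFrom {M : Type*} (σ : List (Request M)) (c : ℕ∞) (path : ℝ → M) :
    (ℕ → Status M) → List Event → Prop
  | _, [] => True
  | st, e :: es => e.Legal σ c path st ∧ LegalFrom σ c path (e.apply σ path st) es

/-- The behaviour of a server: its position at all times `t ≥ 0` and its loading and unloading
events. -/
structure Route (M : Type*) where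
  path : ℝ → M
  events : List Event

/-- The time of the last event (`0` if there is none). For a route that serves all requests this is
the time at which all requests are served. -/
def Route.completion {M : Type*} (R : Route M) : ℝ :=
  (R.events.map Event.time).foldr max 0

/-- `R` is a possible behaviour, ignoring release times, of a server with capacity `c` and at most
unit speed that starts in `x` when the requests have statuses `st`. -/
structure Route.Valid {M : Type*} [MetricSpace M] (σ : List (Request M)) (c : ℕ∞) (x : M)
    (st : ℕ → Status M) (R : Route M) : Prop where
  start : R.path 0 = x
  speed : ∀ s t : ℝ, 0 ≤ s → 0 ≤ t → dist (R.path s) (R.path t) ≤ |s - t|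
  sorted : R.events.Pairwise fun e e' => e.time ≤ e'.time
  nonneg : ∀ e ∈ R.events, 0 ≤ e.time
  legal : LegalFrom σ c R.path st R.events

/-- In the end all requests of `σ` are served. -/
def Route.ServesAll {M : Type*} (σ : List (Request M)) (st : ℕ → Status M) (R : Route M) : Prop :=
  ∀ j < σ.length, statusAfter σ R.path R.events st j = .delivered

/-- `R` is a possible behaviour for the request sequence `σ`: it starts in the origin `o` at time
`0` and loads no request before its release time. -/
def Route.Feasible {M : Type*} [MetricSpace M] (o : M) (c : ℕ∞) (σ : List (Request M))
    (R : Route M) : Prop :=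
  R.Valid σ c o (fun _ => .waiting) ∧
    ∀ e ∈ R.events, ∀ r, σ[e.idx]? = some r → e.isLoad = true → (r.release : ℝ) ≤ e.time

/-- The optimal offline completion time. The set is bounded below by `0`; it is nonempty if the
space is geodesic and `1 ≤ c`. -/
def opt {M : Type*} [MetricSpace M] (o : M) (c : ℕ∞) (σ : List (Request M)) : ℝ :=
  sInf {T | ∃ R : Route M, R.Feasible o c σ ∧ R.ServesAll σ (fun _ => .waiting) ∧
    T = R.completion}

/-- A deterministic online algorithm: it produces a feasible behaviour for every request sequence,
and what it does until time `t` depends only on the requests released until time `t`. -/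
structure IsOnlineAlgorithm {M : Type*} [MetricSpace M] (o : M) (c : ℕ∞)
    (A : List (Request M) → Route M) : Prop where
  feasible : ∀ σ, IsRequestSequence σ → (A σ).Feasible o c σ
  path_eq : ∀ σ σ', IsRequestSequence σ → IsRequestSequence σ' → ∀ t : ℝ,
    known σ t = known σ' t → ∀ s, 0 ≤ s → s ≤ t → (A σ).path s = (A σ').path s
  events_eq : ∀ σ σ', IsRequestSequence σ → IsRequestSequence σ' → ∀ t : ℝ,
    known σ t = known σ' t →
      (A σ).events.filter (fun e => e.time ≤ t) = (A σ').events.filter (fun e => e.time ≤ t)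

/-- `A` serves all requests of each request sequence within `ρ` times the optimal time. -/
def IsCompetitive {M : Type*} [MetricSpace M] (o : M) (c : ℕ∞) (ρ : ℝ)
    (A : List (Request M) → Route M) : Prop :=
  ∀ σ, IsRequestSequence σ →
    (A σ).ServesAll σ (fun _ => .waiting) ∧ (A σ).completion ≤ ρ * opt o c σ

/-- The competitive ratio of an algorithm (`∞` if it is not `ρ`-competitive for any `ρ`). -/
def algorithmRatio {M : Type*} [MetricSpace M] (o : M) (c : ℕ∞)
    (A : List (Request M) → Route M) : ℝ≥0∞ :=
  sInf {x | ∃ ρ : ℝ, 1 ≤ ρ ∧ IsCompetitive o c ρ A ∧ x = ENNReal.ofReal ρ}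

/-- The competitive ratio of the preemptive open online dial-a-ride problem on `M` with origin `o`
and capacity `c`. -/
def problemRatio (M : Type*) [MetricSpace M] (o : M) (c : ℕ∞) : ℝ≥0∞ :=
  sInf {x | ∃ ρ : ℝ, 1 ≤ ρ ∧ (∃ A, IsOnlineAlgorithm o c A ∧ IsCompetitive o c ρ A) ∧
    x = ENNReal.ofReal ρ}

/-- A behaviour of finite duration `dur`; its time starts at `0`. -/
structure Schedule (M : Type*) extends Route M where
  dur : ℝ

/-- `S` can be executed from position `x` and statuses `st`; afterwards the server stands still. -/
structure Schedule.Valid {M : Type*} [MetricSpace M] (σ : List (Request M)) (c : ℕ∞) (x : M)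
    (st : ℕ → Status M) (S : Schedule M) : Prop where
  route : S.toRoute.Valid σ c x st
  dur_nonneg : 0 ≤ S.dur
  events_le : ∀ e ∈ S.events, e.time ≤ S.dur
  still : ∀ s, S.dur ≤ s → S.path s = S.path S.dur

/-- `S` starts in `x` and serves all requests of `σ` that are not served yet. -/
def Schedule.Serves {M : Type*} [MetricSpace M] (σ : List (Request M)) (c : ℕ∞) (x : M)
    (st : ℕ → Status M) (S : Schedule M) : Prop :=
  S.Valid σ c x st ∧ S.ServesAll σ st

/-- `S` starts in `x`, finishes serving all requests that have been loaded before, whether they are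
on board or parked, touches no other request, and returns to the origin `o`. -/
def Schedule.ReturnsHome {M : Type*} [MetricSpace M] (o : M) (σ : List (Request M)) (c : ℕ∞) (x : M)
    (st : ℕ → Status M) (S : Schedule M) : Prop :=
  S.Valid σ c x st ∧ (∀ e ∈ S.events, st e.idx ≠ .waiting) ∧
    (∀ j < σ.length, st j ≠ .waiting → statusAfter σ S.path S.events st j = .delivered) ∧
    S.path S.dur = o

/-- `S` has the property `P`, and no schedule with that property is shorter. -/
def Schedule.IsShortest {M : Type*} (P : Schedule M → Prop) (S : Schedule M) : Prop :=
  P S ∧ ∀ S', P S' → S.dur ≤ S'.dur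

/-- A choice of optimal sub-schedules. If the unserved requests of `σ` are at their starting
positions and form the set `R`, then `serve σ x st` is a shortest preemptive schedule `S(R, x)`;
and `home σ x st` is a fastest execution of `deliver_and_return`. -/
structure OptimalSubschedules {M : Type*} [MetricSpace M] (o : M) (c : ℕ∞) where
  serve : List (Request M) → M → (ℕ → Status M) → Schedule M
  home : List (Request M) → M → (ℕ → Status M) → Schedule M
  serve_shortest : ∀ σ x st, (∀ j, st j = .waiting ∨ st j = .delivered) →
    (∃ S : Schedule M, S.Serves σ c x st) →
    Schedule.IsShortest (fun S => S.Serves σ c x st) (serve σ x st)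
  home_shortest : ∀ σ x st, (∃ S : Schedule M, S.ReturnsHome o σ c x st) →
    Schedule.IsShortest (fun S => S.ReturnsHome o σ c x st) (home σ x st)

/-- The part of a schedule that remains after time `s`. -/
def Schedule.drop {M : Type*} (S : Schedule M) (s : ℝ) : Schedule M where
  path u := S.path (s + u)
  events := (S.events.filter fun e => s < e.time).map fun e => { e with time := e.time - s }
  dur := max (S.dur - s) 0

/-- Delay events by `s`. -/
def delay (s : ℝ) (es : List Event) : List Event :=
  es.map fun e => { e with time := s + e.time }

/-- The state of `Lazy` after it has handled the arrival of a request at time `now`. As long as no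
further request arrives, everything it will do is determined: it completes the command `cmd`, begun
or resumed at time `now`, becomes idle, waits until time `start`, and then follows the schedule
`next` (which is trivial if there are no unserved requests). `past` is its behaviour up to time
`now`. -/
structure LazyState (M : Type*) where
  now : ℝ
  past : Route M
  cmd : Schedule M
  start : ℝ
  next : Schedule M

/-- The behaviour of `Lazy` if no further request arrives. -/
def LazyState.route {M : Type*} (L : LazyState M) : Route M where
  path u := if u ≤ L.now then L.past.path u
    else if u ≤ L.start then L.cmd.path (u - L.now)
    else L.next.path (u - L.start)
  events := L.past.events ++ delay L.now L.cmd.events ++ delay L.start L.next.events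

/-- The behaviour up to time `t ≥ now`. At time `start` itself the schedule `next` has not begun:
a request that arrives at this time is taken into account first. -/
def LazyState.pastAt {M : Type*} (L : LazyState M) (t : ℝ) : Route M where
  path := L.route.path
  events := if t ≤ L.start
    then L.past.events ++ delay L.now (L.cmd.events.filter fun e => e.time ≤ t - L.now)
    else L.past.events ++ delay L.now L.cmd.events ++
      delay L.start (L.next.events.filter fun e => e.time ≤ t - L.start)

/-- What remains at time `t ≥ now` of the command under execution; this is the trivial schedule if
the server is waiting or idle. -/
def LazyState.current {M : Type*} (L : LazyState M) (t : ℝ) : Schedule M :=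
  if t ≤ L.start then L.cmd.drop (t - L.now) else L.next.drop (t - L.start)

/-- The server is in the origin and has nothing to do. -/
def LazyState.init {M : Type*} (o : M) : LazyState M where
  now := 0
  past := { path := fun _ => o, events := [] }
  cmd := { path := fun _ => o, events := [], dur := 0 }
  start := 0
  next := { path := fun _ => o, events := [], dur := 0 }

open Classical in
/-- The reaction of `Lazy(α)` to the arrival of the request `r` of `σ`, at time `t`.

* If the server can finish serving all requests it has loaded and return to the origin until time
  `α * Opt(t)`, it executes `deliver_and_return`; otherwise it goes on with its current command.
* On becoming idle thereafter, it waits until time `α * Opt(t)` if that is not over yet, and then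
  follows a shortest schedule for all unserved requests from its position. -/
def LazyState.step {M : Type*} [MetricSpace M] {o : M} {c : ℕ∞} (α : ℝ)
    (C : OptimalSubschedules o c) (σ : List (Request M)) (L : LazyState M) (r : Request M) :
    LazyState M :=
  let t : ℝ := r.release
  let K := known σ t
  let past := L.pastAt t
  let cur := L.current t
  let pos := cur.path 0
  let st := statusAfter K past.path past.events fun _ => .waiting
  let cmd := if ∃ S : Schedule M, S.ReturnsHome o K c pos st ∧ t + S.dur ≤ α * opt o c K
    then C.home K pos st else cur
  { now := t
    past := past
    cmd := cmd
    start := max (t + cmd.dur) (α * opt o c K)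
    next := C.serve K (cmd.path cmd.dur) (statusAfter K cmd.path cmd.events st) }

/-- The algorithm `Lazy(α)`, run with the chosen optimal preemptive sub-schedules. -/
def lazy {M : Type*} [MetricSpace M] {o : M} {c : ℕ∞} (α : ℝ) (C : OptimalSubschedules o c)
    (σ : List (Request M)) : Route M :=
  (σ.foldl (LazyState.step α C σ) (LazyState.init o)).route

end DialARide

end

open DialARide

noncomputable section

set_option linter.unusedSectionVars false

namespace DialARide

/-! ### Event lists and their effect on statuses -/

section Events

variable {M : Type*} {σ σ' : List (Request M)} {c : ℕ∞} {path path' : ℝ → M}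
  {st st' : ℕ → Status M} {es es' : List Event} {e : Event} {j : ℕ}

/-! Write w for the optimum of the known requests K and z for the completion time of an offline
solution of K; z may be thought of as w. By induction over the arrivals, `LazyState.Invariant` keeps
the server in one of two modes. Either its command ends in the origin by time αw. Then it departs at
time αw, the offline solution itself is a schedule it could follow, and everything is served by
(1+α)w (`LazyState.Invariant.bound_home`). Or it still completes a schedule of duration s for the
open requests of an earlier K₀ with optimum x. That schedule began at some t₀ ≥ αx and ends by
(1+α)x, by induction; the requests it leaves open were released at t₀ or later. Being unable to
return in time forces w ≤ 2αx ≤ 2t₀ (`Admissible.opt_le_of_far`).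

In the second mode (`LazyState.Invariant.bound_following`) let p be the end of the current schedule.
The next one is at most as long as joining the offline server where it is at time t₀ and imitating
it until z. As p is a destination, the offline server visits p at some time e. If e ≥ t₀, the next
schedule takes at most 2z - 2t₀. If (1-β)x ≤ e ≤ t₀, it takes at most z - e, and the total is at
most (α+β)x + z = α²x + z ≤ αt₀ + z. This is the reason for the equation α² = α + β. If e < (1-β)x ≤
x/2, then p is close to the origin and one request of the current schedule was released early, so
this schedule must have started in the origin. Let q be the place where the offline server serves
the last of its requests, at time y. Then s ≤ y and s ≤ x, and the server's tour from o via q to p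
has length at most x, so that d(p,q) ≤ βx (`ShortDetour`); the bound follows on joining the offline
server from p via q. In every metric space β = 2/3 is possible, on the half-line β = 1/2.

Shortest schedules need not exist in a general space. The analysis therefore allows an error of ε
times the optimum, loses 4ε in the ratio, and lets ε tend to 0. On the half-line they do exist: all
stops can be moved into a finite set without lengthening the tour (`exists_moved_tour`), and then
the lengths lie in a finitely generated monoid of nonnegative reals, which is well-ordered
(`exists_shortest`). -/

@[simp] theorem statusAfter_nil : statusAfter σ path [] st = st := rfl

@[simp] theorem statusAfter_cons :
    statusAfter σ path (e :: es) st = statusAfter σ path es (e.apply σ path st) := rfl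

theorem statusAfter_append : statusAfter σ path (es ++ es') st =
    statusAfter σ path es' (statusAfter σ path es st) := by
  simp [statusAfter, List.foldl_append]

@[simp] theorem legalFrom_nil : LegalFrom σ c path st [] := trivial

@[simp] theorem legalFrom_cons : LegalFrom σ c path st (e :: es) ↔
    e.Legal σ c path st ∧ LegalFrom σ c path (e.apply σ path st) es := Iff.rfl

theorem legalFrom_append : LegalFrom σ c path st (es ++ es') ↔
    LegalFrom σ c path st es ∧ LegalFrom σ c path (statusAfter σ path es st) es' := by
  induction es generalizing st with
  | nil => simp
  | cons e es ih => simp [ih, and_assoc]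

/-- Two events that concern the same request, have the same kind and happen at the same place. -/
structure Event.Similar (σ σ' : List (Request M)) (path path' : ℝ → M) (e e' : Event) : Prop where
  idx : e'.idx = e.idx
  isLoad : e'.isLoad = e.isLoad
  place : path' e'.time = path e.time
  request : σ'[e.idx]? = σ[e.idx]?

theorem Event.Similar.apply_eq {e' : Event} (h : e.Similar σ σ' path path' e') :
    e'.apply σ' path' st = e.apply σ path st := by
  obtain ⟨t, i, b⟩ := e
  obtain ⟨t', i', b'⟩ := e'
  obtain ⟨rfl, rfl, h3, h4⟩ := h
  simp only at h3 h4
  simp only [Event.apply, h3]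
  have hc : (∃ r, σ'[i']? = some r ∧ path' t' = r.dst) ↔ ∃ r, σ[i']? = some r ∧ path t = r.dst := by
    rw [h3, h4]
  by_cases h : ∃ r, σ[i']? = some r ∧ path t = r.dst
  · simp only [if_pos h, if_pos (hc.2 h)]
  · simp only [if_neg h, if_neg (mt hc.1 h)]

theorem Event.Similar.legal_iff {e' : Event} (h : e.Similar σ σ' path path' e') :
    e'.Legal σ' c path' st ↔ e.Legal σ c path st := by
  simp only [Event.Legal, h.idx, h.isLoad, h.place, h.request]

/-- The effect of an event depends only on its request, its kind and its place. Shifting time,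
changing the path away from the events and extending the request list are all instances. -/
theorem statusAfter_map {g : Event → Event} (h : ∀ e ∈ es, e.Similar σ σ' path path' (g e)) :
    statusAfter σ' path' (es.map g) st = statusAfter σ path es st := by
  induction es generalizing st with
  | nil => rfl
  | cons e es ih =>
    rw [List.map_cons, statusAfter_cons, statusAfter_cons, (h e (by simp)).apply_eq]
    exact ih fun e he => h e (by simp [he])

theorem legalFrom_map {g : Event → Event} (h : ∀ e ∈ es, e.Similar σ σ' path path' (g e)) :
    LegalFrom σ' c path' st (es.map g) ↔ LegalFrom σ c path st es := by
  induction es generalizing st with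
  | nil => simp
  | cons e es ih =>
    rw [List.map_cons, legalFrom_cons, legalFrom_cons, (h e (by simp)).apply_eq,
      (h e (by simp)).legal_iff, ih fun e he => h e (by simp [he])]

theorem statusAfter_congr (h : ∀ e ∈ es, e.Similar σ σ' path path' e) :
    statusAfter σ' path' es st = statusAfter σ path es st := by
  simpa using statusAfter_map (g := id) (st := st) h

theorem legalFrom_congr (h : ∀ e ∈ es, e.Similar σ σ' path path' e) :
    LegalFrom σ' c path' st es ↔ LegalFrom σ c path st es := by
  simpa using legalFrom_map (g := id) (st := st) (c := c) h

theorem Event.apply_of_ne (h : e.idx ≠ j) : e.apply σ path st j = st j := by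
  simp [Event.apply, Function.update_of_ne (Ne.symm h)]

theorem Event.apply_idx_ne_waiting : e.apply σ path st e.idx ≠ .waiting := by
  simp only [Event.apply, Function.update_self]
  split_ifs <;> simp

theorem statusAfter_of_forall_ne (h : ∀ e ∈ es, e.idx ≠ j) :
    statusAfter σ path es st j = st j := by
  induction es generalizing st with
  | nil => rfl
  | cons e es ih =>
    rw [statusAfter_cons, ih fun e he => h e (by simp [he]), Event.apply_of_ne (h e (by simp))]

theorem statusAfter_ne_waiting (h : st j ≠ .waiting) :
    statusAfter σ path es st j ≠ .waiting := by
  induction es generalizing st with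
  | nil => exact h
  | cons e es ih =>
    refine ih (st := e.apply σ path st) ?_
    by_cases he : e.idx = j
    · subst he; exact Event.apply_idx_ne_waiting
    · rwa [Event.apply_of_ne he]

theorem Event.Legal.idx_lt (h : e.Legal σ c path st) : e.idx < σ.length := by
  obtain ⟨r, hr, -⟩ := h
  exact (List.getElem?_eq_some_iff.1 hr).1

theorem LegalFrom.idx_lt (h : LegalFrom σ c path st es) : ∀ e ∈ es, e.idx < σ.length := by
  induction es generalizing st with
  | nil => simp
  | cons e es ih =>
    rw [legalFrom_cons] at h
    rintro e' he'
    rcases List.mem_cons.1 he' with rfl | he'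
    · exact h.1.idx_lt
    · exact ih h.2 e' he'

theorem Event.Legal.ne_delivered (h : e.Legal σ c path st) : st e.idx ≠ .delivered := by
  obtain ⟨r, hr, h1, h2⟩ := h
  intro hd
  cases hb : e.isLoad with
  | true => simpa [hd, Status.spot] using (h1 hb).1
  | false => simpa [hd] using h2 hb

/-- A delivered request lies at no loading spot and is not on board, so no event can touch it again.
-/
theorem LegalFrom.idx_ne_of_delivered (h : LegalFrom σ c path st es) (hj : st j = .delivered) :
    ∀ e ∈ es, e.idx ≠ j := by
  induction es generalizing st with
  | nil => simp
  | cons e es ih =>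
    rw [legalFrom_cons] at h
    have hne : e.idx ≠ j := fun he => h.1.ne_delivered (he ▸ hj)
    rintro e' he'
    rcases List.mem_cons.1 he' with rfl | he'
    · exact hne
    · exact ih h.2 (by rwa [Event.apply_of_ne hne]) e' he'

theorem similar_of_prefix (hσ : σ <+: σ') (h : e.idx < σ.length) :
    e.Similar σ σ' path path e := by
  obtain ⟨t, rfl⟩ := hσ
  exact ⟨rfl, rfl, rfl, List.getElem?_append_left h⟩

theorem LegalFrom.extend (h : LegalFrom σ c path st es) (hσ : σ <+: σ') :
    LegalFrom σ' c path st es :=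
  (legalFrom_congr fun e he => similar_of_prefix hσ (h.idx_lt e he)).2 h

theorem LegalFrom.statusAfter_extend (h : LegalFrom σ c path st es) (hσ : σ <+: σ') :
    statusAfter σ' path es st = statusAfter σ path es st :=
  statusAfter_congr fun e he => similar_of_prefix hσ (h.idx_lt e he)

open Classical in
/-- The events that concern the requests in `I`. -/
def restrictTo (I : Set ℕ) (es : List Event) : List Event :=
  es.filter fun e => e.idx ∈ I

theorem mem_restrictTo {I : Set ℕ} : e ∈ restrictTo I es ↔ e ∈ es ∧ e.idx ∈ I := by
  simp [restrictTo]

theorem statusAfter_restrictTo {I : Set ℕ} (hI : ∀ j ∈ I, st' j = st j) (hj : j ∈ I) :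
    statusAfter σ path (restrictTo I es) st' j = statusAfter σ path es st j := by
  induction es generalizing st st' with
  | nil => exact hI j hj
  | cons e es ih =>
    by_cases he : e.idx ∈ I
    · have : restrictTo I (e :: es) = e :: restrictTo I es := by simp [restrictTo, he]
      rw [this, statusAfter_cons, statusAfter_cons]
      refine ih fun i hi => ?_
      by_cases hei : e.idx = i
      · subst hei; simp [Event.apply]
      · rw [Event.apply_of_ne hei, Event.apply_of_ne hei, hI i hi]
    · have : restrictTo I (e :: es) = restrictTo I es := by simp [restrictTo, he]
      rw [this, statusAfter_cons]
      refine ih fun i hi => ?_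
      rw [Event.apply_of_ne (fun h => he (h ▸ hi)), hI i hi]

theorem statusAfter_restrictTo_of_notMem {I : Set ℕ} (hj : j ∉ I) :
    statusAfter σ path (restrictTo I es) st j = st j :=
  statusAfter_of_forall_ne fun _ he h => hj (by rw [← h]; exact (mem_restrictTo.1 he).2)

/-- Requests interact only through the capacity, and deleting events frees capacity. The deleted
requests must not be on board initially, since nothing would ever unload them. -/
theorem LegalFrom.restrictTo {I : Set ℕ} (h : LegalFrom σ c path st es)
    (hI : ∀ j ∈ I, st' j = st j) (hc : ∀ j ∉ I, st' j ≠ .carried) :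
    LegalFrom σ c path st' (restrictTo I es) := by
  induction es generalizing st st' with
  | nil => trivial
  | cons e es ih =>
    rw [legalFrom_cons] at h
    by_cases he : e.idx ∈ I
    · have : DialARide.restrictTo I (e :: es) = e :: DialARide.restrictTo I es := by
        simp [DialARide.restrictTo, he]
      rw [this, legalFrom_cons]
      constructor
      · obtain ⟨r, hr, h1, h2⟩ := h.1
        refine ⟨r, hr, fun hb => ?_, fun hb => by rw [hI _ he]; exact h2 hb⟩
        rw [hI _ he]
        refine ⟨(h1 hb).1, lt_of_le_of_lt (Set.encard_le_encard ?_) (h1 hb).2⟩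
        intro i hi
        by_cases hiI : i ∈ I
        · simpa [hI i hiI] using hi
        · exact absurd hi (hc i hiI)
      · refine ih h.2 (fun i hi => ?_) fun i hi => ?_
        · by_cases hei : e.idx = i
          · subst hei; simp [Event.apply]
          · rw [Event.apply_of_ne hei, Event.apply_of_ne hei, hI i hi]
        · rw [Event.apply_of_ne (ne_of_mem_of_not_mem he hi)]; exact hc i hi
    · have : DialARide.restrictTo I (e :: es) = DialARide.restrictTo I es := by
        simp [DialARide.restrictTo, he]
      rw [this]
      refine ih h.2 (fun i hi => ?_) hc
      rw [Event.apply_of_ne (fun h => he (h ▸ hi)), hI i hi]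

theorem filter_le_append_filter_lt (h : es.Pairwise fun e e' => e.time ≤ e'.time) (s : ℝ) :
    (es.filter fun e => e.time ≤ s) ++ (es.filter fun e => s < e.time) = es := by
  induction es with
  | nil => rfl
  | cons e es ih =>
    rw [List.pairwise_cons] at h
    by_cases he : e.time ≤ s
    · simp [he, ih h.2]
    · have h1 : (es.filter fun e => e.time ≤ s) = [] := by
        rw [List.filter_eq_nil_iff]
        intro e' he'
        have := h.1 e' he'
        simp; linarith
      have h2 : (es.filter fun e => s < e.time) = es := by
        rw [List.filter_eq_self]
        intro e' he'
        have := h.1 e' he'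
        simp; linarith
      simp [he, h1, h2, not_le.1 he]

/-- The first event of a request that waits is its loading at the starting position. -/
theorem LegalFrom.exists_first (h : LegalFrom σ c path st es)
    (hs : es.Pairwise fun e e' => e.time ≤ e'.time) (hw : st j = .waiting) (he : e ∈ es)
    (hej : e.idx = j) :
    ∃ e₀ ∈ es, e₀.idx = j ∧ e₀.isLoad = true ∧ e₀.time ≤ e.time ∧
      ∃ r, σ[j]? = some r ∧ path e₀.time = r.src := by
  induction es generalizing st with
  | nil => simp at he
  | cons f es ih =>
    rw [legalFrom_cons] at h
    rw [List.pairwise_cons] at hs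
    by_cases hf : f.idx = j
    · obtain ⟨⟨r, hr, h1, h2⟩, -⟩ := h
      have hb : f.isLoad = true := by
        by_contra hb
        have := h2 (by simpa using hb)
        rw [hf, hw] at this
        simp at this
      refine ⟨f, by simp, hf, hb, ?_, r, hf ▸ hr, ?_⟩
      · rcases List.mem_cons.1 he with rfl | he
        · exact le_rfl
        · exact hs.1 e he
      · have := (h1 hb).1
        rw [hf, hw] at this
        simpa [Status.spot] using this.symm
    · rcases List.mem_cons.1 he with rfl | he
      · exact absurd hej hf
      · obtain ⟨e₀, h0, h1⟩ := ih h.2 hs.2 (by rwa [Event.apply_of_ne hf]) he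
        exact ⟨e₀, by simp [h0], h1⟩

/-- A request that becomes served is unloaded at its destination. -/
theorem exists_delivery (hw : st j ≠ .delivered)
    (hd : statusAfter σ path es st j = .delivered) :
    ∃ e ∈ es, e.idx = j ∧ ∃ r, σ[j]? = some r ∧ path e.time = r.dst := by
  induction es generalizing st with
  | nil => exact absurd hd hw
  | cons e es ih =>
    rw [statusAfter_cons] at hd
    by_cases hx : e.apply σ path st j = .delivered
    · refine ⟨e, by simp, ?_⟩
      by_cases he : e.idx = j
      · subst he
        refine ⟨rfl, ?_⟩
        simp only [Event.apply, Function.update_self] at hx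
        split_ifs at hx with h1 h2
        exact h2
      · rw [Event.apply_of_ne he] at hx
        exact absurd hx hw
    · obtain ⟨e', h0, h1⟩ := ih hx hd
      exact ⟨e', by simp [h0], h1⟩

/-- If all requests concerned end up served, then the last event happens at a destination. -/
theorem exists_last (hne : es ≠ [])
    (hd : ∀ e ∈ es, statusAfter σ path es st e.idx = .delivered)
    (hs : es.Pairwise fun e e' => e.time ≤ e'.time) :
    ∃ e ∈ es, (∀ e' ∈ es, e'.time ≤ e.time) ∧
      ∃ r, σ[e.idx]? = some r ∧ path e.time = r.dst := by
  obtain ⟨l, e, rfl⟩ : ∃ l e, es = l ++ [e] :=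
    ⟨es.dropLast, es.getLast hne, (List.dropLast_append_getLast hne).symm⟩
  refine ⟨e, by simp, ?_, ?_⟩
  · rw [List.pairwise_append] at hs
    intro e' he'
    rcases List.mem_append.1 he' with h | h
    · exact hs.2.2 e' h e (by simp)
    · rw [List.mem_singleton.1 h]
  · have := hd e (by simp)
    rw [statusAfter_append] at this
    simp only [statusAfter_cons, statusAfter_nil, Event.apply, Function.update_self] at this
    split_ifs at this with h1 h2
    exact h2

theorem pairwise_filter_time {p : Event → Bool} (h : es.Pairwise fun e e' => e.time ≤ e'.time) :
    (es.filter p).Pairwise fun e e' => e.time ≤ e'.time :=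
  h.sublist List.filter_sublist

theorem pairwise_delay {s : ℝ} (h : es.Pairwise fun e e' => e.time ≤ e'.time) :
    (delay s es).Pairwise fun e e' => e.time ≤ e'.time := by
  rw [delay, List.pairwise_map]
  exact h.imp fun h => by simpa using h

theorem mem_delay {s : ℝ} : e ∈ delay s es ↔ ∃ e' ∈ es, { e' with time := s + e'.time } = e := by
  simp [delay]

theorem statusAfter_delay {s : ℝ} (h : ∀ e ∈ es, path' (s + e.time) = path e.time) :
    statusAfter σ path' (delay s es) st = statusAfter σ path es st :=
  statusAfter_map fun e he => ⟨rfl, rfl, h e he, rfl⟩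

theorem legalFrom_delay {s : ℝ} (h : ∀ e ∈ es, path' (s + e.time) = path e.time) :
    LegalFrom σ c path' st (delay s es) ↔ LegalFrom σ c path st es :=
  legalFrom_map fun e he => ⟨rfl, rfl, h e he, rfl⟩

end Events

/-- Clamping time to an interval is nonexpansive, so a path frozen outside the interval keeps unit
speed. -/
theorem abs_clamp_sub_clamp_le (s t d : ℝ) :
    |max 0 (min s d) - max 0 (min t d)| ≤ |s - t| := by
  rw [max_comm 0, max_comm 0]
  exact (abs_max_sub_max_le_abs _ _ _).trans (abs_min_sub_min_le_max s d t d |>.trans (by simp))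

/-! ### Concatenating, cutting and prolonging schedules -/

section Schedules

variable {M : Type*} [MetricSpace M] {σ σ' : List (Request M)} {c : ℕ∞} {x y : M}
  {st st' : ℕ → Status M} {R T : Route M} {S S' : Schedule M} {d : ℝ}

/-- Follow `R` until time `d` and `T` afterwards. -/
def Route.append (R : Route M) (d : ℝ) (T : Route M) : Route M where
  path u := if u ≤ d then R.path u else T.path (u - d)
  events := R.events ++ delay d T.events

theorem Route.append_path_of_le {u : ℝ} (h : u ≤ d) : (R.append d T).path u = R.path u := by
  simp [Route.append, h]

theorem Route.append_path_add (h : T.path 0 = R.path d) {u : ℝ} (hu : 0 ≤ u) :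
    (R.append d T).path (d + u) = T.path u := by
  rcases hu.eq_or_lt with rfl | hu
  · simp [Route.append, h]
  · simp [Route.append, hu]

theorem Route.statusAfter_append (h : T.path 0 = R.path d) (hR : ∀ e ∈ R.events, e.time ≤ d)
    (hT : ∀ e ∈ T.events, 0 ≤ e.time) :
    statusAfter σ (R.append d T).path (R.append d T).events st =
      statusAfter σ T.path T.events (statusAfter σ R.path R.events st) := by
  have h1 : statusAfter σ (R.append d T).path R.events st = statusAfter σ R.path R.events st :=
    statusAfter_congr fun e he => ⟨rfl, rfl, Route.append_path_of_le (hR e he), rfl⟩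
  show statusAfter σ (R.append d T).path (R.events ++ delay d T.events) st = _
  rw [DialARide.statusAfter_append, h1]
  exact statusAfter_delay fun e he => Route.append_path_add h (hT e he)

theorem Route.Valid.append (hR : R.Valid σ c x st) (hd : 0 ≤ d) (hRd : ∀ e ∈ R.events, e.time ≤ d)
    (hT : T.Valid σ c (R.path d) (statusAfter σ R.path R.events st)) :
    (R.append d T).Valid σ c x st where
  start := by rw [Route.append_path_of_le hd, hR.start]
  speed := by
    have key : ∀ s t : ℝ, 0 ≤ s → s ≤ t →
        dist ((R.append d T).path s) ((R.append d T).path t) ≤ t - s := by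
      intro s t hs hst
      rcases le_total t d with htd | htd
      · rw [Route.append_path_of_le htd, Route.append_path_of_le (hst.trans htd)]
        refine (hR.speed s t hs (hs.trans hst)).trans_eq ?_
        rw [abs_sub_comm, abs_of_nonneg (by linarith)]
      · obtain ⟨v, rfl⟩ : ∃ v, t = d + v := ⟨t - d, by ring⟩
        have hv : 0 ≤ v := by linarith
        rw [Route.append_path_add hT.start hv]
        rcases le_total s d with hsd | hsd
        · rw [Route.append_path_of_le hsd]
          have h1 := hR.speed s d hs hd
          have h2 := hT.speed 0 v le_rfl hv
          rw [abs_sub_comm, abs_of_nonneg (by linarith)] at h1 h2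
          rw [hT.start] at h2
          linarith [dist_triangle (R.path s) (R.path d) (T.path v)]
        · obtain ⟨u, rfl⟩ : ∃ u, s = d + u := ⟨s - d, by ring⟩
          have hu : 0 ≤ u := by linarith
          rw [Route.append_path_add hT.start hu]
          have h2 := hT.speed u v hu hv
          rw [abs_sub_comm, abs_of_nonneg (by linarith)] at h2
          linarith
    intro s t hs ht
    rcases le_total s t with h | h
    · rw [abs_sub_comm, abs_of_nonneg (by linarith)]; exact key s t hs h
    · rw [dist_comm, abs_of_nonneg (by linarith)]; exact key t s ht h
  sorted := by
    refine List.pairwise_append.2 ⟨hR.sorted, pairwise_delay hT.sorted, ?_⟩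
    intro e he e' he'
    obtain ⟨f, hf, rfl⟩ := mem_delay.1 he'
    have := hRd e he
    have := hT.nonneg f hf
    simp only
    linarith
  nonneg := by
    intro e he
    rcases List.mem_append.1 he with h | h
    · exact hR.nonneg e h
    · obtain ⟨f, hf, rfl⟩ := mem_delay.1 h
      exact add_nonneg hd (hT.nonneg f hf)
  legal := by
    have h1 : statusAfter σ (R.append d T).path R.events st = statusAfter σ R.path R.events st :=
      statusAfter_congr fun e he => ⟨rfl, rfl, Route.append_path_of_le (hRd e he), rfl⟩
    refine legalFrom_append.2 ⟨?_, ?_⟩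
    · exact (legalFrom_congr
        fun e he => ⟨rfl, rfl, Route.append_path_of_le (hRd e he), rfl⟩).2 hR.legal
    · rw [h1]
      exact (legalFrom_delay
        fun e he => Route.append_path_add hT.start (hT.nonneg e he)).2 hT.legal

theorem Route.Valid.extend (h : R.Valid σ c x st) (hσ : σ <+: σ') : R.Valid σ' c x st :=
  ⟨h.start, h.speed, h.sorted, h.nonneg, h.legal.extend hσ⟩

theorem Schedule.Valid.extend (h : S.Valid σ c x st) (hσ : σ <+: σ') : S.Valid σ' c x st :=
  ⟨h.route.extend hσ, h.dur_nonneg, h.events_le, h.still⟩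

/-- Follow `S` and then `S'`. -/
def Schedule.append (S S' : Schedule M) : Schedule M where
  toRoute := S.toRoute.append S.dur S'.toRoute
  dur := S.dur + S'.dur

theorem Schedule.statusAfter_append (hS : S.Valid σ c x st)
    (hS' : S'.Valid σ' c (S.path S.dur) st') :
    statusAfter σ (S.append S').path (S.append S').events st =
      statusAfter σ S'.path S'.events (statusAfter σ S.path S.events st) :=
  Route.statusAfter_append hS'.route.start hS.events_le hS'.route.nonneg

theorem Schedule.append_end (h : S'.path 0 = S.path S.dur) (hd : 0 ≤ S'.dur) :
    (S.append S').path (S.append S').dur = S'.path S'.dur :=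
  Route.append_path_add h hd

theorem Schedule.Valid.append (hS : S.Valid σ c x st)
    (hS' : S'.Valid σ c (S.path S.dur) (statusAfter σ S.path S.events st)) :
    (S.append S').Valid σ c x st where
  route := hS.route.append hS.dur_nonneg hS.events_le hS'.route
  dur_nonneg := add_nonneg hS.dur_nonneg hS'.dur_nonneg
  events_le := by
    intro e he
    rcases List.mem_append.1 he with h | h
    · exact (hS.events_le e h).trans (le_add_of_nonneg_right hS'.dur_nonneg)
    · obtain ⟨f, hf, rfl⟩ := mem_delay.1 h
      have := hS'.events_le f hf
      show S.dur + f.time ≤ S.dur + S'.dur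
      linarith
  still := by
    intro s hs
    rw [Schedule.append_end hS'.route.start hS'.dur_nonneg]
    have hs' : S.dur + S'.dur ≤ s := hs
    have h0 := hS'.dur_nonneg
    obtain ⟨u, rfl⟩ : ∃ u, s = S.dur + u := ⟨s - S.dur, by ring⟩
    have : (S.append S').path (S.dur + u) = S'.path u :=
      Route.append_path_add hS'.route.start (by linarith)
    rw [this]
    exact hS'.still u (by linarith)

/-- Do nothing for some time. -/
def Schedule.stay (x : M) (d : ℝ) : Schedule M where
  path _ := x
  events := []
  dur := d

theorem Schedule.stay_valid (hd : 0 ≤ d) : (Schedule.stay x d).Valid σ c x st where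
  route := ⟨rfl, fun s t _ _ => by simp [Schedule.stay], List.Pairwise.nil, by simp [Schedule.stay],
    trivial⟩
  dur_nonneg := hd
  events_le := by simp [Schedule.stay]
  still _ _ := rfl

/-- A single event at the current position. -/
def Schedule.act (x : M) (j : ℕ) (b : Bool) : Schedule M where
  path _ := x
  events := [⟨0, j, b⟩]
  dur := 0

theorem Schedule.act_valid {j : ℕ} {b : Bool}
    (h : (⟨0, j, b⟩ : Event).Legal σ c (fun _ => x) st) :
    (Schedule.act x j b).Valid σ c x st where
  route := ⟨rfl, fun s t _ _ => by simp [Schedule.act], by simp [Schedule.act],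
    by simp [Schedule.act], ⟨h, trivial⟩⟩
  dur_nonneg := le_rfl
  events_le := by simp [Schedule.act]
  still _ _ := rfl

/-- The part of a route between two times, with the given events. -/
def Route.segment (R : Route M) (a b : ℝ) (es : List Event) : Schedule M where
  path u := R.path (a + max 0 (min u (b - a)))
  events := es.map fun e => { e with time := e.time - a }
  dur := b - a

section segment

variable {a b : ℝ} {es : List Event}

theorem Route.segment_path {u : ℝ} (hau : a ≤ u) (hub : u ≤ b) :
    (R.segment a b es).path (u - a) = R.path u := by
  have : a + max 0 (min (u - a) (b - a)) = u := by
    rw [min_eq_left (by linarith), max_eq_right (by linarith)]; ring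
  simp [Route.segment, this]

theorem Route.segment_end (hab : a ≤ b) :
    (R.segment a b es).path (R.segment a b es).dur = R.path b :=
  Route.segment_path hab le_rfl

theorem Route.segment_statusAfter (h : ∀ e ∈ es, a ≤ e.time ∧ e.time ≤ b) :
    statusAfter σ (R.segment a b es).path (R.segment a b es).events st =
      statusAfter σ R.path es st :=
  statusAfter_map fun e he => ⟨rfl, rfl, Route.segment_path (h e he).1 (h e he).2, rfl⟩

theorem Route.segment_valid
    (hR : ∀ s t : ℝ, 0 ≤ s → 0 ≤ t → dist (R.path s) (R.path t) ≤ |s - t|)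
    (ha : 0 ≤ a) (hab : a ≤ b) (hs : es.Pairwise fun e e' => e.time ≤ e'.time)
    (h : ∀ e ∈ es, a ≤ e.time ∧ e.time ≤ b) (hl : LegalFrom σ c R.path st es) :
    (R.segment a b es).Valid σ c (R.path a) st where
  route :=
    { start := by simpa using Route.segment_path (R := R) (es := es) le_rfl hab
      speed := by
        intro s t hs ht
        refine (hR _ _ (by positivity) (by positivity)).trans ?_
        rw [add_sub_add_left_eq_sub]
        exact abs_clamp_sub_clamp_le _ _ _
      sorted := by
        show List.Pairwise _ (es.map _)
        rw [List.pairwise_map]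
        exact hs.imp fun h => by simpa using h
      nonneg := by
        intro e he
        obtain ⟨f, hf, rfl⟩ := List.mem_map.1 he
        have := (h f hf).1
        show 0 ≤ f.time - a
        linarith
      legal := (legalFrom_map (g := fun e => { e with time := e.time - a }) fun e he =>
        ⟨rfl, rfl, Route.segment_path (h e he).1 (h e he).2, rfl⟩).2 hl }
  dur_nonneg := sub_nonneg.2 hab
  events_le := by
    intro e he
    obtain ⟨f, hf, rfl⟩ := List.mem_map.1 he
    have := (h f hf).2
    show f.time - a ≤ b - a
    linarith
  still := by
    intro s hs
    have hs' : b - a ≤ s := hs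
    simp [Route.segment, min_eq_right hs']

end segment

/-- The geodesic is controlled only between its end points, hence the clamped parameter. -/
theorem GeodesicSpace.exists_move (hM : GeodesicSpace M) (x y : M) :
    ∃ S : Schedule M, S.events = [] ∧ S.dur = dist x y ∧ S.path S.dur = y ∧
      ∀ (σ : List (Request M)) (c : ℕ∞) (st : ℕ → Status M), S.Valid σ c x st := by
  obtain ⟨γ, h0, h1, h⟩ := hM x y
  have hI : ∀ u : ℝ, max 0 (min u (dist x y)) ∈ Set.Icc 0 (dist x y) := fun u =>
    ⟨le_max_left _ _, max_le dist_nonneg (min_le_right _ _)⟩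
  refine ⟨⟨⟨fun u => γ (max 0 (min u (dist x y))), []⟩, dist x y⟩, rfl, rfl, by simp [h1],
    fun σ c st => ⟨⟨by simp [h0], fun s t _ _ => ?_, List.Pairwise.nil, by simp, trivial⟩,
      dist_nonneg, by simp, fun s hs => ?_⟩⟩
  · rw [h _ (hI s) _ (hI t)]
    exact abs_clamp_sub_clamp_le _ _ _
  · simp only
    rw [min_eq_right hs, min_self]

/-- Prefix a schedule with a shortest move. -/
theorem Schedule.Valid.exists_move_append (hM : GeodesicSpace M) (hS : S.Valid σ c y st) (x : M) :
    ∃ T : Schedule M, T.Valid σ c x st ∧ T.dur = dist x y + S.dur ∧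
      T.path T.dur = S.path S.dur ∧ (∀ e ∈ T.events, ∃ f ∈ S.events, f.idx = e.idx) ∧
      statusAfter σ T.path T.events st = statusAfter σ S.path S.events st := by
  obtain ⟨m, hm, hd, hp, hv⟩ := hM.exists_move x y
  have hS' : S.Valid σ c (m.path m.dur) (statusAfter σ m.path m.events st) := by
    rwa [hp, hm, statusAfter_nil]
  refine ⟨m.append S, (hv σ c st).append hS', by rw [← hd]; rfl,
    Schedule.append_end hS'.route.start hS.dur_nonneg, ?_, ?_⟩
  · intro e he
    have he : e ∈ m.events ++ delay m.dur S.events := he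
    rw [hm, List.nil_append] at he
    obtain ⟨f, hf, rfl⟩ := mem_delay.1 he
    exact ⟨f, hf, rfl⟩
  · rw [Schedule.statusAfter_append (hv σ c st) hS', hm, statusAfter_nil]

/-- Continue a schedule with a shortest move. -/
theorem Schedule.Valid.exists_append_move (hM : GeodesicSpace M) (hS : S.Valid σ c x st) (y : M) :
    ∃ T : Schedule M, T.Valid σ c x st ∧ T.dur = S.dur + dist (S.path S.dur) y ∧
      T.path T.dur = y ∧ T.events = S.events ∧
      statusAfter σ T.path T.events st = statusAfter σ S.path S.events st := by
  obtain ⟨m, hm, hd, hp, hv⟩ := hM.exists_move (S.path S.dur) y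
  have hm' := hv σ c (statusAfter σ S.path S.events st)
  refine ⟨S.append m, hS.append hm', by rw [← hd]; rfl,
    (Schedule.append_end hm'.route.start hm'.dur_nonneg).trans hp, ?_, ?_⟩
  · show S.events ++ delay S.dur m.events = _
    simp [hm, delay]
  · rw [Schedule.statusAfter_append hS hm', hm, statusAfter_nil]

/-- What remains of a schedule is a schedule for the current situation. -/
theorem Schedule.Valid.drop (hS : S.Valid σ c x st) {s : ℝ} (hs : 0 ≤ s) :
    (S.drop s).Valid σ c (S.path s)
      (statusAfter σ S.path (S.events.filter fun e => e.time ≤ s) st) where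
  route :=
    { start := by simp [Schedule.drop]
      speed := by
        intro u v hu hv
        refine (hS.route.speed _ _ (by positivity) (by positivity)).trans_eq ?_
        rw [add_sub_add_left_eq_sub]
      sorted := by
        show List.Pairwise _ (List.map _ _)
        rw [List.pairwise_map]
        exact (pairwise_filter_time hS.route.sorted).imp fun h => by simpa using h
      nonneg := by
        intro e he
        obtain ⟨f, hf, rfl⟩ := List.mem_map.1 he
        have := (List.mem_filter.1 hf).2
        simp only [decide_eq_true_eq] at this
        show 0 ≤ f.time - s
        linarith
      legal := by
        have h := hS.route.legal
        rw [← filter_le_append_filter_lt hS.route.sorted s, legalFrom_append] at h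
        exact (legalFrom_map (g := fun e => { e with time := e.time - s }) fun e he =>
          ⟨rfl, rfl, by simp [Schedule.drop], rfl⟩).2 h.2 }
  dur_nonneg := le_max_right _ _
  events_le := by
    intro e he
    obtain ⟨f, hf, rfl⟩ := List.mem_map.1 he
    have := hS.events_le f (List.mem_filter.1 hf).1
    show f.time - s ≤ max (S.dur - s) 0
    exact le_max_of_le_left (by linarith)
  still := by
    intro u hu
    have hu' : max (S.dur - s) 0 ≤ u := hu
    show S.path (s + u) = S.path (s + max (S.dur - s) 0)
    have h1 := le_max_left (S.dur - s) 0
    rw [hS.still (s + u) (by linarith), hS.still (s + max (S.dur - s) 0) (by linarith)]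

theorem Schedule.statusAfter_drop (hS : S.events.Pairwise fun e e' => e.time ≤ e'.time) (s : ℝ) :
    statusAfter σ (S.drop s).path (S.drop s).events
      (statusAfter σ S.path (S.events.filter fun e => e.time ≤ s) st) =
      statusAfter σ S.path S.events st := by
  have : statusAfter σ S.path S.events st = statusAfter σ S.path
      ((S.events.filter fun e => e.time ≤ s) ++ (S.events.filter fun e => s < e.time)) st := by
    rw [filter_le_append_filter_lt hS s]
  rw [this, DialARide.statusAfter_append]
  exact statusAfter_map fun e he => ⟨rfl, rfl, by simp [Schedule.drop], rfl⟩

theorem Schedule.Valid.drop_end (hS : S.Valid σ c x st) (s : ℝ) :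
    (S.drop s).path (S.drop s).dur = S.path S.dur := by
  show S.path (s + max (S.dur - s) 0) = _
  have h1 := le_max_left (S.dur - s) 0
  exact hS.still _ (by linarith)

end Schedules

/-! ### Offline solutions and bounds on the optimum -/

section Solutions

variable {M : Type*} [MetricSpace M] {σ σ' K K' : List (Request M)} {c : ℕ∞} {o x y : M}
  {st st' : ℕ → Status M} {R O : Route M} {S S' : Schedule M} {d : ℝ} {j n : ℕ} {r : Request M}

theorem exists_serve_one (hM : GeodesicSpace M) (hc : 1 ≤ c) (x : M)
    (hst : ∀ j, st j ≠ .carried) (hw : st n = .waiting) (hr : σ[n]? = some r) :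
    ∃ S : Schedule M, S.Valid σ c x st ∧ S.dur = dist x r.src + dist r.src r.dst ∧
      S.path S.dur = r.dst ∧
      statusAfter σ S.path S.events st = Function.update st n .delivered := by
  set st₁ : ℕ → Status M := Function.update st n .carried with hst₁
  have hA : (Schedule.act r.dst n false).Valid σ c r.dst st₁ :=
    Schedule.act_valid ⟨r, hr, by simp, by simp [hst₁]⟩
  obtain ⟨B, hB, hBd, hBe, -, hBs⟩ := hA.exists_move_append hM r.src
  have hL : (Schedule.act r.src n true).Valid σ c r.src st := by
    refine Schedule.act_valid ⟨r, hr, fun _ => ⟨by simp [hw, Status.spot], ?_⟩, by simp⟩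
    have : {j | st j = Status.carried} = ∅ := by ext j; simp [hst j]
    rw [this, Set.encard_empty]
    exact lt_of_lt_of_le zero_lt_one hc
  have hLs : statusAfter σ (Schedule.act r.src n true).path (Schedule.act r.src n true).events st
      = st₁ := by
    simp [Schedule.act, Event.apply, hst₁]
  have hB' : B.Valid σ c ((Schedule.act r.src n true).path (Schedule.act r.src n true).dur)
      (statusAfter σ (Schedule.act r.src n true).path (Schedule.act r.src n true).events st) := by
    rw [hLs]; exact hB
  obtain ⟨T, hT, hTd, hTe, -, hTs⟩ := (hL.append hB').exists_move_append hM x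
  refine ⟨T, hT, ?_, ?_, ?_⟩
  · rw [hTd]
    show _ + ((0 : ℝ) + B.dur) = _
    rw [hBd]
    show _ + ((0 : ℝ) + (_ + 0)) = _
    ring
  · rw [hTe, Schedule.append_end hB'.route.start hB'.dur_nonneg, hBe]
    rfl
  · rw [hTs, Schedule.statusAfter_append hL hB', hLs, hBs]
    have hd : ∃ r', σ[n]? = some r' ∧ r.dst = r'.dst := ⟨r, hr, rfl⟩
    simp only [Schedule.act, statusAfter_cons, statusAfter_nil, Event.apply, if_pos hd, hst₁]
    simp

/-- The requests are served one after the other, so capacity 1 suffices. The last clause matters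
when the optimum is 0: then all requests sit in one point and cost nothing there. -/
theorem exists_serve_initial (hM : GeodesicSpace M) (hc : 1 ≤ c) (σ : List (Request M)) (x : M)
    (hst : ∀ j, st j = .waiting ∨ st j = .delivered) (hn : n ≤ σ.length) :
    ∃ S : Schedule M, S.Valid σ c x st ∧
      (∀ j < n, statusAfter σ S.path S.events st j = .delivered) ∧
      (∀ j, n ≤ j → statusAfter σ S.path S.events st j = st j) ∧
      ((∀ j r, σ[j]? = some r → st j = .waiting → r.src = x ∧ r.dst = x) →
        S.dur = 0 ∧ S.path S.dur = x) := by
  induction n with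
  | zero =>
    exact ⟨Schedule.stay x 0, Schedule.stay_valid le_rfl, by simp, fun _ _ => rfl,
      fun _ => ⟨rfl, rfl⟩⟩
  | succ n ih =>
    obtain ⟨S, hS, hS1, hS2, hS3⟩ := ih (by omega)
    rcases hst n with hn' | hn'
    · have hr : σ[n]? = some σ[n] := List.getElem?_eq_getElem _
      obtain ⟨T, hT, hTd, hTe, hTs⟩ := exists_serve_one (n := n)
        (st := statusAfter σ S.path S.events st) hM hc (S.path S.dur)
        (fun j => by
          rcases lt_or_ge j n with h | h
          · rw [hS1 j h]; simp
          · rw [hS2 j h]; rcases hst j with h | h <;> rw [h] <;> simp)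
        (by rw [hS2 n le_rfl, hn']) hr
      refine ⟨S.append T, hS.append hT, ?_, ?_, ?_⟩
      · intro j hj
        rw [Schedule.statusAfter_append hS hT, hTs]
        by_cases hjn : j = n
        · subst hjn; simp
        · rw [Function.update_of_ne hjn, hS1 j (by omega)]
      · intro j hj
        rw [Schedule.statusAfter_append hS hT, hTs, Function.update_of_ne (by omega),
          hS2 j (by omega)]
      · intro h
        obtain ⟨h1, h2⟩ := hS3 h
        obtain ⟨h3, h4⟩ := h n _ hr hn'
        refine ⟨?_, ?_⟩
        · show S.dur + T.dur = 0
          rw [hTd, h2, h1, h3, h4]; simp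
        · rw [Schedule.append_end hT.route.start hT.dur_nonneg, hTe, h4]
    · refine ⟨S, hS, fun j hj => ?_, fun j hj => hS2 j (by omega), hS3⟩
      by_cases hjn : j = n
      · subst hjn; rw [hS2 _ le_rfl, hn']
      · exact hS1 j (by omega)

theorem exists_serves (hM : GeodesicSpace M) (hc : 1 ≤ c) (σ : List (Request M)) (x : M)
    (hst : ∀ j, st j = .waiting ∨ st j = .delivered) :
    ∃ S : Schedule M, S.Serves σ c x st := by
  obtain ⟨S, h1, h2, -⟩ := exists_serve_initial hM hc σ x hst le_rfl
  exact ⟨S, h1, h2⟩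

theorem exists_serves_of_eq (hM : GeodesicSpace M) (hc : 1 ≤ c) (x : M)
    (hst : ∀ j, st j = .waiting ∨ st j = .delivered)
    (h : ∀ j r, σ[j]? = some r → st j = .waiting → r.src = y ∧ r.dst = y) :
    ∃ S : Schedule M, S.Serves σ c x st ∧ S.dur = dist x y := by
  obtain ⟨S, h1, h2, -, h3⟩ := exists_serve_initial hM hc σ y hst le_rfl
  obtain ⟨T, hT, hTd, -, -, hTs⟩ := h1.exists_move_append hM x
  refine ⟨T, ⟨hT, fun j hj => ?_⟩, by rw [hTd, (h3 h).1, add_zero]⟩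
  rw [hTs]; exact h2 j hj

theorem Route.time_le_completion {e : Event} (he : e ∈ R.events) : e.time ≤ R.completion := by
  obtain ⟨path, es⟩ := R
  simp only [Route.completion] at he ⊢
  induction es with
  | nil => simp at he
  | cons f l ih =>
    rcases List.mem_cons.1 he with rfl | h
    · simp
    · exact le_max_of_le_right (ih h)

theorem Route.completion_nonneg : 0 ≤ R.completion := by
  obtain ⟨path, es⟩ := R
  simp only [Route.completion]
  induction es with
  | nil => simp
  | cons f l ih => exact le_max_of_le_right ih

theorem Route.completion_le (hd : 0 ≤ d) (h : ∀ e ∈ R.events, e.time ≤ d) :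
    R.completion ≤ d := by
  obtain ⟨path, es⟩ := R
  simp only [Route.completion] at h ⊢
  induction es with
  | nil => simpa
  | cons f l ih =>
    simp only [List.map_cons, List.foldr_cons, max_le_iff]
    exact ⟨h f (by simp), ih fun e he => h e (by simp [he])⟩

/-- `O` is an offline solution for `K`. -/
structure Route.Solves (o : M) (c : ℕ∞) (K : List (Request M)) (O : Route M) : Prop where
  feasible : O.Feasible o c K
  serves : O.ServesAll K fun _ => .waiting

theorem opt_le (h : O.Solves o c K) : opt o c K ≤ O.completion :=
  csInf_le ⟨0, by rintro T ⟨R, -, -, rfl⟩; exact R.completion_nonneg⟩ ⟨O, h.1, h.2, rfl⟩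

/-- Wait until everything is released, then serve. Without a solution `opt` would be the infimum of
the empty set, and lower bounds on it would fail. -/
theorem exists_solves (hM : GeodesicSpace M) (hc : 1 ≤ c) (o : M) (K : List (Request M)) :
    ∃ O : Route M, O.Solves o c K := by
  obtain ⟨S, hS, hS'⟩ := exists_serves (st := fun _ => .waiting) hM hc K o fun _ => .inl rfl
  obtain ⟨T, hT⟩ : ∃ T : ℝ, 0 ≤ T ∧ ∀ r ∈ K, (r.release : ℝ) ≤ T := by
    clear hS hS'
    induction K with
    | nil => exact ⟨0, by simp⟩
    | cons r K ih =>
      obtain ⟨T, h0, h⟩ := ih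
      refine ⟨max T r.release, le_max_of_le_left h0, fun r' hr' => ?_⟩
      rcases List.mem_cons.1 hr' with rfl | h'
      · exact le_max_right _ _
      · exact le_max_of_le_left (h r' h')
  have hW : (Schedule.stay o T).Valid K c o fun _ => .waiting := Schedule.stay_valid hT.1
  have hV := hW.append (S' := S) hS
  refine ⟨((Schedule.stay o T).append S).toRoute, ⟨hV.route, ?_⟩, ?_⟩
  · intro e he r hr _
    have he : e ∈ [] ++ delay T S.events := he
    rw [List.nil_append] at he
    obtain ⟨f, hf, rfl⟩ := mem_delay.1 he
    have := hT.2 r (List.mem_of_getElem? hr)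
    have := hS.route.nonneg f hf
    simp only
    linarith
  · intro j hj
    rw [Schedule.statusAfter_append hW (S' := S) hS]
    exact hS' j hj

theorem le_opt (hM : GeodesicSpace M) (hc : 1 ≤ c) {b : ℝ}
    (h : ∀ O : Route M, O.Solves o c K → b ≤ O.completion) : b ≤ opt o c K := by
  obtain ⟨O, hO⟩ := exists_solves hM hc o K
  refine le_csInf ⟨_, O, hO.1, hO.2, rfl⟩ ?_
  rintro T ⟨R, h1, h2, rfl⟩
  exact h R ⟨h1, h2⟩

theorem opt_nonneg : 0 ≤ opt o c K :=
  Real.sInf_nonneg (by rintro T ⟨R, -, -, rfl⟩; exact R.completion_nonneg)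

/-- A bound with a slack that vanishes for near-optimal solutions holds without the slack. -/
theorem le_of_forall_solves (hM : GeodesicSpace M) (hc : 1 ≤ c) {a b C : ℝ} (hC : 0 < C)
    (h : ∀ O : Route M, O.Solves o c K → a ≤ b + C * (O.completion - opt o c K)) : a ≤ b := by
  -- The hypothesis makes this left side a lower bound for every solution, hence for the infimum.
  have : opt o c K + (a - b) / C ≤ opt o c K := le_opt hM hc fun O hO => by
    have := h O hO
    have : (a - b) / C ≤ O.completion - opt o c K := by
      rw [div_le_iff₀ hC]; linarith
    linarith
  have h2 : (a - b) / C ≤ 0 := by linarith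
  by_contra hab
  have : 0 < (a - b) / C := div_pos (by linarith) hC
  linarith

namespace Route.Solves

theorem release_le (h : O.Solves o c K) {e : Event} (he : e ∈ O.events) (hr : K[e.idx]? = some r) :
    (r.release : ℝ) ≤ e.time := by
  obtain ⟨e₀, h0, h1, h2, h3, -⟩ := h.1.1.legal.exists_first h.1.1.sorted rfl he rfl
  exact (h.1.2 e₀ h0 r (by rwa [h1]) h2).trans h3

theorem exists_delivery (h : O.Solves o c K) (hr : K[j]? = some r) :
    ∃ e ∈ O.events, e.idx = j ∧ O.path e.time = r.dst ∧ (r.release : ℝ) ≤ e.time ∧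
      dist o r.dst ≤ e.time := by
  have hj : j < K.length := (List.getElem?_eq_some_iff.1 hr).1
  obtain ⟨e, he, rfl, r', hr', hp⟩ := DialARide.exists_delivery (by simp) (h.serves j hj)
  obtain rfl : r = r' := by simpa [hr] using hr'
  refine ⟨e, he, rfl, hp, h.release_le he hr, ?_⟩
  have := h.1.1.speed 0 e.time le_rfl (h.1.1.nonneg e he)
  rwa [h.1.1.start, hp, abs_sub_comm, sub_zero, abs_of_nonneg (h.1.1.nonneg e he)] at this

theorem dist_le (h : O.Solves o c K) {s t : ℝ} (hs : 0 ≤ s) (hst : s ≤ t) :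
    dist (O.path s) (O.path t) ≤ t - s := by
  have := h.1.1.speed s t hs (hs.trans hst)
  rwa [abs_sub_comm, abs_of_nonneg (by linarith)] at this

/-- A solution of a longer sequence, restricted to the requests that are still waiting, is a
schedule for them. -/
theorem exists_serves (h : O.Solves o c K) (hM : GeodesicSpace M) (hK : K' <+: K)
    (hst : ∀ j, st j = .waiting ∨ st j = .delivered) {a b : ℝ} (ha : 0 ≤ a) (hab : a ≤ b)
    (he : ∀ e ∈ O.events, e.idx < K'.length → st e.idx = .waiting → a ≤ e.time ∧ e.time ≤ b)
    (p : M) : ∃ S : Schedule M, S.Serves K' c p st ∧ S.dur = dist p (O.path a) + (b - a) := by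
  set I : Set ℕ := {j | j < K'.length ∧ st j = .waiting} with hI
  have hnc : ∀ j ∉ I, st j ≠ .carried := fun j _ => by
    rcases hst j with h | h <;> rw [h] <;> simp
  -- The waiting requests have the same status as at the beginning of the offline solution, so its
  -- events for them stay legal when all others are dropped.
  have hleg : LegalFrom K' c O.path st (restrictTo I O.events) := by
    have := h.1.1.legal.restrictTo (I := I) (st' := st) (fun j hj => hj.2) hnc
    exact (legalFrom_congr fun e he =>
      similar_of_prefix hK (mem_restrictTo.1 he).2.1).1 this
  have htime : ∀ e ∈ restrictTo I O.events, a ≤ e.time ∧ e.time ≤ b := fun e h' =>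
    he e (mem_restrictTo.1 h').1 (mem_restrictTo.1 h').2.1 (mem_restrictTo.1 h').2.2
  have hv := Route.segment_valid h.1.1.speed ha hab
    (es := restrictTo I O.events) (pairwise_filter_time h.1.1.sorted) htime hleg
  obtain ⟨T, hT, hTd, -, -, hTs⟩ := hv.exists_move_append hM p
  refine ⟨T, ⟨hT, fun j hj => ?_⟩, hTd⟩
  rw [hTs, Route.segment_statusAfter htime]
  by_cases hjI : j ∈ I
  · have h1 : statusAfter K' O.path (restrictTo I O.events) st =
        statusAfter K O.path (restrictTo I O.events) st :=
      (statusAfter_congr fun e he => similar_of_prefix hK (mem_restrictTo.1 he).2.1).symm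
    rw [h1, statusAfter_restrictTo (st := fun _ => .waiting) (fun j hj => hj.2) hjI]
    exact h.serves j (hj.trans_le hK.length_le)
  · rw [statusAfter_restrictTo_of_notMem hjI]
    exact (hst j).resolve_left fun hw => hjI ⟨hj, hw⟩

end Route.Solves

theorem release_le_opt (hM : GeodesicSpace M) (hc : 1 ≤ c) (hr : r ∈ K) :
    (r.release : ℝ) ≤ opt o c K := by
  obtain ⟨j, hj⟩ := List.mem_iff_getElem?.1 hr
  refine le_opt hM hc fun O hO => ?_
  obtain ⟨e, he, -, -, h, -⟩ := hO.exists_delivery hj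
  exact h.trans (Route.time_le_completion he)

theorem dist_dst_le_opt (hM : GeodesicSpace M) (hc : 1 ≤ c) (hr : r ∈ K) :
    dist o r.dst ≤ opt o c K := by
  obtain ⟨j, hj⟩ := List.mem_iff_getElem?.1 hr
  refine le_opt hM hc fun O hO => ?_
  obtain ⟨e, he, -, -, -, h⟩ := hO.exists_delivery hj
  exact h.trans (Route.time_le_completion he)

theorem dist_src_le_opt (hM : GeodesicSpace M) (hc : 1 ≤ c) (hr : r ∈ K) :
    dist o r.src ≤ opt o c K := by
  obtain ⟨j, hj⟩ := List.mem_iff_getElem?.1 hr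
  refine le_opt hM hc fun O hO => ?_
  obtain ⟨e, he, hej, -⟩ := hO.exists_delivery hj
  obtain ⟨e₀, h0, h1, h2, h3, r', hr', hp⟩ :=
    hO.1.1.legal.exists_first hO.1.1.sorted rfl he hej
  obtain rfl : r = r' := by simpa [hj] using hr'
  have := hO.dist_le le_rfl (hO.1.1.nonneg e₀ h0)
  rw [hO.1.1.start, hp, sub_zero] at this
  exact this.trans (Route.time_le_completion h0)

/-- Dropping the events of the later requests turns a solution of the longer sequence into one of
the prefix that is no slower. -/
theorem opt_mono (hM : GeodesicSpace M) (hc : 1 ≤ c) (hK : K' <+: K) :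
    opt o c K' ≤ opt o c K := by
  refine le_opt hM hc fun O hO => ?_
  set I : Set ℕ := {j | j < K'.length} with hI
  have hsim : ∀ e ∈ restrictTo I O.events, e.Similar K' K O.path O.path e := fun e he =>
    similar_of_prefix hK (mem_restrictTo.1 he).2
  have hleg : LegalFrom K' c O.path (fun _ => .waiting) (restrictTo I O.events) :=
    (legalFrom_congr hsim).1 (hO.1.1.legal.restrictTo (fun _ _ => rfl) (by simp))
  have hS : Route.Solves o c K' ⟨O.path, restrictTo I O.events⟩ := by
    refine ⟨⟨⟨hO.1.1.start, hO.1.1.speed, pairwise_filter_time hO.1.1.sorted,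
      fun e he => hO.1.1.nonneg e (mem_restrictTo.1 he).1, hleg⟩, ?_⟩, ?_⟩
    · intro e he r hr hb
      exact hO.1.2 e (mem_restrictTo.1 he).1 r (by rw [(hsim e he).request, hr]) hb
    · intro j hj
      rw [← statusAfter_congr hsim]
      rw [statusAfter_restrictTo (st := fun _ => .waiting) (fun _ _ => rfl)
        (show j ∈ I from hj)]
      exact hO.serves j (hj.trans_le hK.length_le)
  refine (opt_le hS).trans (Route.completion_le Route.completion_nonneg fun e he => ?_)
  exact Route.time_le_completion (mem_restrictTo.1 he).1

end Solutions

/-! ### The behaviour encoded by a state, and its soundness -/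

section Behaviour

variable {M : Type*} [MetricSpace M] {K K' : List (Request M)} {c : ℕ∞} {o x : M}
  {st : ℕ → Status M} {R : Route M} {L : LazyState M} {t : ℝ}

theorem Route.Valid.of_append {es es' : List Event} (h : R.Valid K c x st)
    (hes : R.events = es ++ es') : Route.Valid K c x st ⟨R.path, es⟩ where
  start := h.start
  speed := h.speed
  sorted := h.sorted.sublist (by rw [hes]; exact List.sublist_append_left _ _)
  nonneg e he := h.nonneg e (by rw [hes]; exact List.mem_append_left _ he)
  legal := (legalFrom_append.1 (hes ▸ h.legal)).1

/-- The statuses when the state was reached. -/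
def LazyState.status (K : List (Request M)) (L : LazyState M) : ℕ → Status M :=
  statusAfter K L.past.path L.past.events fun _ => .waiting

/-- The statuses when the command under execution ends. -/
def LazyState.endStatus (K : List (Request M)) (L : LazyState M) : ℕ → Status M :=
  statusAfter K L.cmd.path L.cmd.events (L.status K)

/-- The position at the end of the command under execution. -/
def LazyState.endPos (L : LazyState M) : M :=
  L.cmd.path L.cmd.dur

/-- The behaviour described by the state is possible and serves all requests of `K`. -/
structure LazyState.Sound (o : M) (c : ℕ∞) (K : List (Request M)) (L : LazyState M) : Prop where
  now_nonneg : 0 ≤ L.now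
  release_le : ∀ r ∈ K, (r.release : ℝ) ≤ L.now
  past : L.past.Feasible o c K
  past_le : ∀ e ∈ L.past.events, e.time ≤ L.now
  cmd : L.cmd.Valid K c (L.past.path L.now) (L.status K)
  le_start : L.now + L.cmd.dur ≤ L.start
  finished : ∀ j, L.endStatus K j = .waiting ∨ L.endStatus K j = .delivered
  next : L.next.Serves K c L.endPos (L.endStatus K)

theorem delay_append {s : ℝ} {es es' : List Event} :
    delay s (es ++ es') = delay s es ++ delay s es' := List.map_append

theorem delay_delay {s u : ℝ} {es : List Event} : delay s (delay u es) = delay (s + u) es := by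
  simp [delay, add_assoc]

/-- Reduces the three-phase behaviour to concatenations, for which validity and final statuses are
already known. -/
theorem LazyState.route_eq_append (L : LazyState M) :
    L.route = L.past.append L.now (L.cmd.toRoute.append (L.start - L.now) L.next.toRoute) := by
  simp only [LazyState.route, Route.append, delay_append, delay_delay, List.append_assoc,
    Route.mk.injEq]
  refine ⟨?_, by rw [add_sub_cancel]⟩
  funext u
  have h : u - L.now - (L.start - L.now) = u - L.start := by ring
  simp only [sub_le_sub_iff_right, h]

namespace LazyState.Sound

variable (h : L.Sound o c K)
include h

theorem now_le_start : L.now ≤ L.start :=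
  (le_add_of_nonneg_right h.cmd.dur_nonneg).trans h.le_start

theorem cmd_end : L.cmd.path (L.start - L.now) = L.endPos :=
  h.cmd.still _ (by linarith [h.le_start])

theorem rest_valid : (L.cmd.toRoute.append (L.start - L.now) L.next.toRoute).Valid K c
    (L.past.path L.now) (L.status K) := by
  refine h.cmd.route.append (by linarith [h.now_le_start]) (fun e he => ?_) ?_
  · linarith [h.cmd.events_le e he, h.le_start]
  · rw [h.cmd_end]; exact h.next.1.route

theorem route_valid : L.route.Valid K c o fun _ => .waiting := by
  rw [L.route_eq_append]
  exact h.past.1.append h.now_nonneg h.past_le h.rest_valid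

theorem route_statusAfter : statusAfter K L.route.path L.route.events (fun _ => .waiting) =
    statusAfter K L.next.path L.next.events (L.endStatus K) := by
  rw [L.route_eq_append, Route.statusAfter_append h.rest_valid.start h.past_le h.rest_valid.nonneg,
    Route.statusAfter_append]
  · rfl
  · rw [h.cmd_end]; exact h.next.1.route.start
  · intro e he
    linarith [h.cmd.events_le e he, h.le_start]
  · exact h.next.1.route.nonneg

theorem route_serves : L.route.ServesAll K fun _ => .waiting := by
  intro j hj
  rw [h.route_statusAfter]
  exact h.next.2 j hj

theorem mem_route_events {e : Event} (he : e ∈ L.route.events) :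
    e ∈ L.past.events ∨ L.now ≤ e.time := by
  rcases List.mem_append.1 he with he | he
  · rcases List.mem_append.1 he with he | he
    · exact .inl he
    · obtain ⟨f, hf, rfl⟩ := mem_delay.1 he
      have := h.cmd.route.nonneg f hf
      exact .inr (by simp only; linarith)
  · obtain ⟨f, hf, rfl⟩ := mem_delay.1 he
    have := h.next.1.route.nonneg f hf
    have := h.now_le_start
    exact .inr (by simp only; linarith)

theorem route_feasible : L.route.Feasible o c K := by
  refine ⟨h.route_valid, fun e he r hr hb => ?_⟩
  rcases h.mem_route_events he with he | he
  · exact h.past.2 e he r hr hb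
  · exact (h.release_le r (List.mem_of_getElem? hr)).trans he

theorem completion_le : L.route.completion ≤ L.start + L.next.dur := by
  have h1 := h.now_le_start
  have h2 := h.next.1.dur_nonneg
  have h3 := h.now_nonneg
  refine Route.completion_le (by linarith) fun e he => ?_
  rcases List.mem_append.1 he with he | he
  · rcases List.mem_append.1 he with he | he
    · linarith [h.past_le e he]
    · obtain ⟨f, hf, rfl⟩ := mem_delay.1 he
      have := h.cmd.events_le f hf
      have := h.le_start
      simp only; linarith
  · obtain ⟨f, hf, rfl⟩ := mem_delay.1 he
    have := h.next.1.events_le f hf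
    simp only; linarith

theorem route_path_of_le {u : ℝ} (hu : u ≤ L.now) : L.route.path u = L.past.path u := by
  rw [L.route_eq_append, Route.append_path_of_le hu]

theorem route_path_now_add {u : ℝ} (hu : 0 ≤ u) (hu' : L.now + u ≤ L.start) :
    L.route.path (L.now + u) = L.cmd.path u := by
  rw [L.route_eq_append, Route.append_path_add h.rest_valid.start hu,
    Route.append_path_of_le (by linarith)]

theorem route_path_start_add {u : ℝ} (hu : 0 ≤ u) :
    L.route.path (L.start + u) = L.next.path u := by
  have h1 := h.now_le_start
  have : L.start + u = L.now + ((L.start - L.now) + u) := by ring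
  rw [L.route_eq_append, this, Route.append_path_add h.rest_valid.start (by linarith),
    Route.append_path_add _ hu]
  rw [h.cmd_end]; exact h.next.1.route.start

theorem statusAfter_past : statusAfter K L.route.path L.past.events (fun _ => .waiting) =
    L.status K :=
  statusAfter_congr fun e he => ⟨rfl, rfl, h.route_path_of_le (h.past_le e he), rfl⟩

/-- Sorted events make the past an initial segment of the planned behaviour; validity of the past is
inherited from this. -/
theorem pastAt_prefix (t : ℝ) : ∃ es, L.route.events = (L.pastAt t).events ++ es := by
  unfold LazyState.pastAt
  by_cases ht : t ≤ L.start
  · refine ⟨delay L.now (L.cmd.events.filter fun e => t - L.now < e.time) ++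
      delay L.start L.next.events, ?_⟩
    rw [if_pos ht, ← List.append_assoc]
    conv_rhs => rw [List.append_assoc L.past.events, ← delay_append,
      filter_le_append_filter_lt h.cmd.route.sorted]
    rfl
  · refine ⟨delay L.start (L.next.events.filter fun e => t - L.start < e.time), ?_⟩
    rw [if_neg ht]
    conv_rhs => rw [List.append_assoc, ← delay_append,
      filter_le_append_filter_lt h.next.1.route.sorted]
    rfl

theorem pastAt_valid (t : ℝ) : (L.pastAt t).Valid K c o fun _ => .waiting := by
  obtain ⟨es, hes⟩ := h.pastAt_prefix t
  exact h.route_valid.of_append hes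

theorem pastAt_feasible (t : ℝ) (hK : K <+: K') : (L.pastAt t).Feasible o c K' := by
  obtain ⟨es, hes⟩ := h.pastAt_prefix t
  have hv := h.route_valid.of_append hes
  refine ⟨hv.extend hK, fun e he r hr hb => ?_⟩
  have hr' : K[e.idx]? = some r := by
    rw [← hr]
    exact (similar_of_prefix (path := L.route.path) hK
      (hv.legal.idx_lt e he)).request.symm
  exact h.route_feasible.2 e (by rw [hes]; exact List.mem_append_left _ he) r hr' hb

theorem pastAt_le (ht : L.now ≤ t) : ∀ e ∈ (L.pastAt t).events, e.time ≤ t := by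
  intro e he
  unfold LazyState.pastAt at he
  by_cases hts : t ≤ L.start
  · simp only [if_pos hts] at he
    rcases List.mem_append.1 he with he | he
    · exact (h.past_le e he).trans ht
    · obtain ⟨f, hf, rfl⟩ := mem_delay.1 he
      have := (List.mem_filter.1 hf).2
      simp only [decide_eq_true_eq] at this
      simp only; linarith
  · simp only [if_neg hts] at he
    rcases List.mem_append.1 he with he | he
    · rcases List.mem_append.1 he with he | he
      · exact (h.past_le e he).trans ht
      · obtain ⟨f, hf, rfl⟩ := mem_delay.1 he
        have := h.cmd.events_le f hf
        have := h.le_start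
        simp only; linarith
    · obtain ⟨f, hf, rfl⟩ := mem_delay.1 he
      have := (List.mem_filter.1 hf).2
      simp only [decide_eq_true_eq] at this
      simp only; linarith

theorem statusAfter_pastAt_extend (hK : K <+: K') (t : ℝ) :
    statusAfter K' (L.pastAt t).path (L.pastAt t).events (fun _ => .waiting) =
      statusAfter K (L.pastAt t).path (L.pastAt t).events (fun _ => .waiting) :=
  (h.pastAt_valid t).legal.statusAfter_extend hK

theorem statusAfter_pastAt_of_le (ht : t ≤ L.start) :
    statusAfter K (L.pastAt t).path (L.pastAt t).events (fun _ => .waiting) =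
      statusAfter K L.cmd.path (L.cmd.events.filter fun e => e.time ≤ t - L.now) (L.status K) := by
  have : (L.pastAt t).events =
      L.past.events ++ delay L.now (L.cmd.events.filter fun e => e.time ≤ t - L.now) := by
    simp [LazyState.pastAt, ht]
  rw [this, statusAfter_append]
  show statusAfter K L.route.path _ (statusAfter K L.route.path _ _) = _
  rw [h.statusAfter_past]
  refine statusAfter_delay fun e he => ?_
  have he := (List.mem_filter.1 he).1
  exact h.route_path_now_add (h.cmd.route.nonneg e he)
    (by linarith [h.cmd.events_le e he, h.le_start])

theorem statusAfter_cmd : statusAfter K L.route.path (L.past.events ++ delay L.now L.cmd.events)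
    (fun _ => .waiting) = L.endStatus K := by
  rw [statusAfter_append, h.statusAfter_past]
  exact statusAfter_delay fun e he => h.route_path_now_add (h.cmd.route.nonneg e he)
    (by linarith [h.cmd.events_le e he, h.le_start])

theorem statusAfter_pastAt_of_lt (ht : L.start < t) :
    statusAfter K (L.pastAt t).path (L.pastAt t).events (fun _ => .waiting) =
      statusAfter K L.next.path (L.next.events.filter fun e => e.time ≤ t - L.start)
        (L.endStatus K) := by
  have : (L.pastAt t).events = L.past.events ++ delay L.now L.cmd.events ++
      delay L.start (L.next.events.filter fun e => e.time ≤ t - L.start) := by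
    simp [LazyState.pastAt, not_le.2 ht]
  rw [this, statusAfter_append]
  show statusAfter K L.route.path _ (statusAfter K L.route.path _ _) = _
  rw [h.statusAfter_cmd]
  exact statusAfter_delay fun e he =>
    h.route_path_start_add (h.next.1.route.nonneg e (List.mem_filter.1 he).1)

theorem pastAt_path (ht : L.now ≤ t) : (L.pastAt t).path t = (L.current t).path 0 := by
  show L.route.path t = _
  unfold LazyState.current
  by_cases hts : t ≤ L.start
  · rw [if_pos hts]
    have := h.route_path_now_add (u := t - L.now) (by linarith) (by linarith)
    rw [add_sub_cancel] at this
    simpa [Schedule.drop] using this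
  · rw [if_neg hts]
    have := h.route_path_start_add (u := t - L.start) (by linarith)
    rw [add_sub_cancel] at this
    simpa [Schedule.drop] using this

theorem current_valid (ht : L.now ≤ t) : (L.current t).Valid K c ((L.current t).path 0)
    (statusAfter K (L.pastAt t).path (L.pastAt t).events fun _ => .waiting) := by
  by_cases hts : t ≤ L.start
  · rw [h.statusAfter_pastAt_of_le hts]
    unfold LazyState.current
    rw [if_pos hts]
    simpa [Schedule.drop] using h.cmd.drop (s := t - L.now) (by linarith)
  · rw [h.statusAfter_pastAt_of_lt (not_le.1 hts)]
    unfold LazyState.current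
    rw [if_neg hts]
    simpa [Schedule.drop] using h.next.1.drop (s := t - L.start) (by linarith)

theorem current_statusAfter_of_le (ht : t ≤ L.start) :
    statusAfter K (L.current t).path (L.current t).events
      (statusAfter K (L.pastAt t).path (L.pastAt t).events fun _ => .waiting) =
      L.endStatus K := by
  rw [h.statusAfter_pastAt_of_le ht]
  unfold LazyState.current
  rw [if_pos ht, Schedule.statusAfter_drop h.cmd.route.sorted]
  rfl

theorem current_statusAfter_of_lt (ht : L.start < t) :
    statusAfter K (L.current t).path (L.current t).events
      (statusAfter K (L.pastAt t).path (L.pastAt t).events fun _ => .waiting) =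
      statusAfter K L.next.path L.next.events (L.endStatus K) := by
  rw [h.statusAfter_pastAt_of_lt ht]
  unfold LazyState.current
  rw [if_neg (not_le.2 ht), Schedule.statusAfter_drop h.next.1.route.sorted]

theorem current_end_of_le (ht : t ≤ L.start) :
    (L.current t).path (L.current t).dur = L.endPos := by
  unfold LazyState.current
  rw [if_pos ht, h.cmd.drop_end]; rfl

theorem current_end_of_lt (ht : L.start < t) :
    (L.current t).path (L.current t).dur = L.next.path L.next.dur := by
  unfold LazyState.current
  rw [if_neg (not_le.2 ht), h.next.1.drop_end]

theorem add_current_dur_of_le (ht : t ≤ L.start) :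
    t + (L.current t).dur = max (L.now + L.cmd.dur) t := by
  unfold LazyState.current
  rw [if_pos ht]
  show t + max (L.cmd.dur - (t - L.now)) 0 = _
  rw [← max_add_add_left]
  congr 1 <;> ring

theorem add_current_dur_of_lt (ht : L.start < t) :
    t + (L.current t).dur = max (L.start + L.next.dur) t := by
  unfold LazyState.current
  rw [if_neg (not_le.2 ht)]
  show t + max (L.next.dur - (t - L.start)) 0 = _
  rw [← max_add_add_left]
  congr 1 <;> ring

theorem next_statusAfter (j : ℕ) :
    statusAfter K L.next.path L.next.events (L.endStatus K) j =
      if j < K.length then .delivered else .waiting := by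
  split_ifs with hj
  · exact h.next.2 j hj
  · rw [← h.route_statusAfter]
    exact statusAfter_of_forall_ne fun e he => by
      have := h.route_valid.legal.idx_lt e he
      omega

/-- Whichever command is running, its end leaves no request on board or parked. This is why a
`serve` schedule can be requested after it. -/
theorem current_finished (j : ℕ) :
    statusAfter K (L.current t).path (L.current t).events
      (statusAfter K (L.pastAt t).path (L.pastAt t).events fun _ => .waiting) j = .waiting ∨
    statusAfter K (L.current t).path (L.current t).events
      (statusAfter K (L.pastAt t).path (L.pastAt t).events fun _ => .waiting) j = .delivered := by
  rcases le_or_gt t L.start with ht | ht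
  · rw [h.current_statusAfter_of_le ht]; exact h.finished j
  · rw [h.current_statusAfter_of_lt ht, h.next_statusAfter]
    split_ifs <;> simp

end LazyState.Sound

end Behaviour

/-! ### The strategy with abstract subroutines -/

section Algorithm

variable {M : Type*} [MetricSpace M]

/-- Subroutines of the lazy strategy: `serve` computes a schedule for all unserved requests; `home`
is given the current time and a deadline and may return a schedule that finishes the requests loaded
so far and returns to the origin before the deadline. -/
structure Subroutines (M : Type*) where
  serve : List (Request M) → M → (ℕ → Status M) → Schedule M
  home : List (Request M) → M → (ℕ → Status M) → ℝ → ℝ → Option (Schedule M)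

/-- The subroutine `serve` is optimal up to an error of `ε` times the offline optimum, and ends at
the destination of a request; `home` meets the deadline whenever this is possible. -/
structure Subroutines.Good (ε : ℝ) (o : M) (c : ℕ∞) (A : Subroutines M) : Prop where
  serves : ∀ σ x st, (∀ j, st j = .waiting ∨ st j = .delivered) →
    (A.serve σ x st).Serves σ c x st
  le : ∀ σ x st, (∀ j, st j = .waiting ∨ st j = .delivered) → ∀ S : Schedule M,
    S.Serves σ c x st → (A.serve σ x st).dur ≤ S.dur + ε * opt o c σ
  endpoint : ∀ σ x st, (∀ j, st j = .waiting ∨ st j = .delivered) →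
    (∃ j < σ.length, st j = .waiting) → ∃ j r, σ[j]? = some r ∧ st j = .waiting ∧
      (A.serve σ x st).path (A.serve σ x st).dur = r.dst
  home_some : ∀ σ x st t T S, A.home σ x st t T = some S →
    S.ReturnsHome o σ c x st ∧ t + S.dur ≤ T
  home_none : ∀ σ x st t T, A.home σ x st t T = none → ∀ S : Schedule M,
    S.ReturnsHome o σ c x st → T < t + S.dur

/-- The reaction to a request at time `t` if `K` are the requests known at this time. -/
def Subroutines.step (A : Subroutines M) (o : M) (c : ℕ∞) (α : ℝ) (K : List (Request M)) (t : ℝ)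
    (L : LazyState M) : LazyState M :=
  let past := L.pastAt t
  let cur := L.current t
  let pos := cur.path 0
  let st := statusAfter K past.path past.events fun _ => .waiting
  let cmd := (A.home K pos st t (α * opt o c K)).getD cur
  { now := t
    past := past
    cmd := cmd
    start := max (t + cmd.dur) (α * opt o c K)
    next := A.serve K (cmd.path cmd.dur) (statusAfter K cmd.path cmd.events st) }

/-- The state after the requests `l` of the sequence `σ` have been handled. -/
def Subroutines.run (A : Subroutines M) (o : M) (c : ℕ∞) (α : ℝ) (σ l : List (Request M)) :
    LazyState M :=
  l.foldl (fun L r => A.step o c α (known σ r.release) r.release L) (LazyState.init o)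

/-- The lazy strategy with the given subroutines. -/
def Subroutines.algorithm (A : Subroutines M) (o : M) (c : ℕ∞) (α : ℝ) (σ : List (Request M)) :
    Route M :=
  (A.run o c α σ σ).route

variable {K K' : List (Request M)} {c : ℕ∞} {o x : M} {ε α : ℝ} {A : Subroutines M}
  {st : ℕ → Status M} {L : LazyState M} {t : ℝ}

theorem LazyState.init_sound (o : M) (c : ℕ∞) : (LazyState.init o).Sound o c [] where
  now_nonneg := le_rfl
  release_le := by simp
  past := ⟨(Schedule.stay_valid (d := 0) le_rfl).route, by simp [LazyState.init]⟩
  past_le := by simp [LazyState.init]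
  cmd := Schedule.stay_valid (d := 0) le_rfl
  le_start := by simp [LazyState.init]
  finished _ := .inl rfl
  next := ⟨Schedule.stay_valid (d := 0) le_rfl, by intro j hj; simp at hj⟩

/-- Such a schedule cannot touch waiting requests and must finish all others; the indices beyond the
list are waiting as well. -/
theorem Schedule.ReturnsHome.statusAfter {S : Schedule M} (h : S.ReturnsHome o K c x st)
    (hst : ∀ j, K.length ≤ j → st j = .waiting) (j : ℕ) :
    DialARide.statusAfter K S.path S.events st j = .waiting ∧ st j = .waiting ∨
      DialARide.statusAfter K S.path S.events st j = .delivered ∧ st j ≠ .waiting := by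
  by_cases hw : st j = .waiting
  · refine .inl ⟨?_, hw⟩
    rw [statusAfter_of_forall_ne fun e he hj => h.2.1 e he (hj ▸ hw), hw]
  · exact .inr ⟨h.2.2.1 j (by by_contra hj; exact hw (hst j (by omega))) hw, hw⟩

namespace LazyState.Sound

theorem pastAt_waiting (h : L.Sound o c K) (t : ℝ) {j : ℕ} (hj : K.length ≤ j) :
    statusAfter K (L.pastAt t).path (L.pastAt t).events (fun _ => Status.waiting) j = .waiting :=
  statusAfter_of_forall_ne fun e he => by
    have := (h.pastAt_valid t).legal.idx_lt e he
    omega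

theorem step (h : L.Sound o c K) (hA : A.Good ε o c) (hK : K <+: K')
    (hr : ∀ r ∈ K', (r.release : ℝ) ≤ t) (ht : L.now ≤ t) :
    (A.step o c α K' t L).Sound o c K' := by
  set L' := A.step o c α K' t L with hL'
  have hst : L'.status K' = statusAfter K (L.pastAt t).path (L.pastAt t).events
      fun _ => .waiting := h.statusAfter_pastAt_extend hK t
  have hpos : L'.past.path L'.now = (L.current t).path 0 := h.pastAt_path ht
  have hcmd : L'.cmd = (A.home K' ((L.current t).path 0) (L'.status K') t
    (α * opt o c K')).getD (L.current t) := rfl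
  have key : L'.cmd.Valid K' c (L'.past.path L'.now) (L'.status K') ∧
      ∀ j, L'.endStatus K' j = .waiting ∨ L'.endStatus K' j = .delivered := by
    cases hh : A.home K' ((L.current t).path 0) (L'.status K') t (α * opt o c K') with
    | some S =>
      rw [hh, Option.getD_some] at hcmd
      have hS := (hA.home_some _ _ _ _ _ _ hh).1
      refine ⟨by rw [hcmd, hpos]; exact hS.1, fun j => ?_⟩
      have := hS.statusAfter (fun j hj => ?_) j
      · unfold LazyState.endStatus
        rw [hcmd]
        tauto
      · rw [hst]; exact h.pastAt_waiting t (hK.length_le.trans hj)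
    | none =>
      rw [hh, Option.getD_none] at hcmd
      have hv := h.current_valid ht
      rw [← hst] at hv
      refine ⟨by rw [hcmd, hpos]; exact hv.extend hK, fun j => ?_⟩
      unfold LazyState.endStatus
      rw [hcmd, hv.route.legal.statusAfter_extend hK, hst]
      exact h.current_finished j
  exact
    { now_nonneg := h.now_nonneg.trans ht
      release_le := hr
      past := h.pastAt_feasible t hK
      past_le := h.pastAt_le ht
      cmd := key.1
      le_start := le_max_left _ _
      finished := key.2
      next := hA.serves _ _ _ key.2 }

end LazyState.Sound

theorem Subroutines.step_route_path {u : ℝ} (hu : u ≤ t) (K : List (Request M)) :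
    (A.step o c α K t L).route.path u = L.route.path u := by
  show (if u ≤ t then L.route.path u else _) = _
  rw [if_pos hu]

theorem filter_delay_eq_nil {s u : ℝ} {es : List Event} (h : ∀ e ∈ es, 0 ≤ e.time) (hu : u < s) :
    (delay s es).filter (fun e => e.time ≤ u) = [] := by
  rw [List.filter_eq_nil_iff]
  intro e he
  obtain ⟨f, hf, rfl⟩ := mem_delay.1 he
  have := h f hf
  simp; linarith

theorem filter_delay_filter {s u t : ℝ} {es : List Event} (hu : u ≤ t) :
    (delay s (es.filter fun e => e.time ≤ t - s)).filter (fun e => e.time ≤ u) =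
      (delay s es).filter fun e => e.time ≤ u := by
  simp only [delay, List.filter_map, List.filter_filter]
  congr 1
  refine List.filter_congr fun e _ => ?_
  by_cases h : s + e.time ≤ u
  · have : e.time ≤ t - s := by linarith
    simp [h, this]
  · simp [h]

theorem LazyState.Sound.filter_pastAt (h : L.Sound o c K) {u : ℝ} (hu : u < t) :
    (L.pastAt t).events.filter (fun e => e.time ≤ u) =
      L.route.events.filter fun e => e.time ≤ u := by
  unfold LazyState.pastAt LazyState.route
  by_cases hts : t ≤ L.start
  · simp only [if_pos hts, List.filter_append, filter_delay_filter hu.le,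
      filter_delay_eq_nil h.next.1.route.nonneg (hu.trans_le hts), List.append_nil]
  · simp only [if_neg hts, List.filter_append, filter_delay_filter hu.le]

/-- Only new events at time t or later are planned. The inequality u < t is strict because the
replaced plan may differ at t itself. -/
theorem LazyState.Sound.filter_step (h : L.Sound o c K) (hA : A.Good ε o c) (hK : K <+: K')
    (hr : ∀ r ∈ K', (r.release : ℝ) ≤ t) (ht : L.now ≤ t) {u : ℝ} (hu : u < t) :
    (A.step o c α K' t L).route.events.filter (fun e => e.time ≤ u) =
      L.route.events.filter fun e => e.time ≤ u := by
  have hS := h.step (α := α) hA hK hr ht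
  rw [← h.filter_pastAt hu]
  have hn : (A.step o c α K' t L).now = t := rfl
  have h1 : (A.step o c α K' t L).route.events = (L.pastAt t).events ++
      delay t (A.step o c α K' t L).cmd.events ++
      delay (A.step o c α K' t L).start (A.step o c α K' t L).next.events := rfl
  have h2 := hS.now_le_start
  rw [hn] at h2
  rw [h1, List.filter_append, List.filter_append,
    filter_delay_eq_nil hS.cmd.route.nonneg hu,
    filter_delay_eq_nil hS.next.1.route.nonneg (hu.trans_le h2), List.append_nil, List.append_nil]

/-! ### Known requests, the run and the online property -/

section known

variable {σ σ' l l' : List (Request M)} {r : Request M} {s u : ℝ}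

theorem mem_known : r ∈ known σ t ↔ r ∈ σ ∧ (r.release : ℝ) ≤ t := by
  simp [known]

theorem known_known (h : s ≤ t) : known (known σ t) s = known σ s := by
  simp only [known, List.filter_filter]
  refine List.filter_congr fun r _ => ?_
  by_cases h' : (r.release : ℝ) ≤ s
  · simp [h', h'.trans h]
  · simp [h']

theorem IsRequestSequence.known_append (h : IsRequestSequence σ) (t : ℝ) :
    known σ t ++ σ.filter (fun r => t < r.release) = σ := by
  unfold IsRequestSequence at h
  induction σ with
  | nil => rfl
  | cons r σ ih =>
    rw [List.pairwise_cons] at h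
    by_cases hr : (r.release : ℝ) ≤ t
    · have := ih h.2
      simp only [known] at this ⊢
      simp [hr, this]
    · have h1 : known σ t = [] := by
        rw [known, List.filter_eq_nil_iff]
        intro r' hr'
        have : (r.release : ℝ) ≤ r'.release := h.1 r' hr'
        simp only [decide_eq_true_eq]; linarith
      have := ih h.2
      simp only [known] at h1 this ⊢
      rw [h1] at this
      simp [hr, not_le.1 hr, h1]
      simpa using this

theorem IsRequestSequence.known_prefix (h : IsRequestSequence σ) (t : ℝ) : known σ t <+: σ :=
  ⟨_, h.known_append t⟩

theorem IsRequestSequence.known (h : IsRequestSequence σ) (t : ℝ) :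
    IsRequestSequence (known σ t) :=
  h.sublist List.filter_sublist

theorem IsRequestSequence.known_prefix_known (h : IsRequestSequence σ) (hst : s ≤ t) :
    DialARide.known σ s <+: DialARide.known σ t := by
  rw [← known_known hst]
  exact (h.known t).known_prefix s

/-- Induction along the run: `P` is given the requests known in a state, and the state. -/
theorem Subroutines.run_induction (hσ : IsRequestSequence σ)
    {P : List (Request M) → LazyState M → Prop} (h0 : P [] (LazyState.init o))
    (hstep : ∀ K L t, P K L → ∀ K', K <+: K' → L.now ≤ t → (∀ r ∈ K', (r.release : ℝ) ≤ t) →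
      (∀ j r, K.length ≤ j → K'[j]? = some r → (r.release : ℝ) = t) →
      (K'.length ≤ K.length → L.now = t) → (∃ r ∈ K', (r.release : ℝ) = t) → P K' (A.step o c α K' t L))
    (hl : l ++ l' = σ) :
    l = [] ∨ P (DialARide.known σ (A.run o c α σ l).now) (A.run o c α σ l) ∧
      (∀ r ∈ l, (r.release : ℝ) ≤ (A.run o c α σ l).now) ∧
      ∃ r ∈ l, (A.run o c α σ l).now = r.release := by
  induction l using List.reverseRecOn generalizing l' with
  | nil => exact .inl rfl
  | append_singleton l r ih =>
    right
    have hrun : A.run o c α σ (l ++ [r]) = A.step o c α (DialARide.known σ r.release) r.release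
        (A.run o c α σ l) := by simp [Subroutines.run]
    have hnow : (A.run o c α σ (l ++ [r])).now = r.release := by rw [hrun]; rfl
    have hsort : ∀ r' ∈ l, r'.release ≤ r.release := by
      subst hl
      have := (List.pairwise_append.1 (List.pairwise_append.1 hσ).1).2.2
      exact fun r' hr' => this r' hr' r (by simp)
    have hsort' : ∀ r' ∈ l', r.release ≤ r'.release := by
      subst hl
      exact fun r' hr' => (List.pairwise_append.1 hσ).2.2 r (by simp) r' hr'
    have hmem : r ∈ DialARide.known σ r.release := mem_known.2 ⟨by simp [← hl], le_rfl⟩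
    have hle : ∀ r' ∈ DialARide.known σ r.release, (r'.release : ℝ) ≤ r.release :=
      fun r' hr' => (mem_known.1 hr').2
    refine ⟨?_, ?_, r, by simp, hnow⟩
    swap
    · intro r' hr'
      rw [hnow]
      rcases List.mem_append.1 hr' with h | h
      · exact hsort r' h
      · rw [List.mem_singleton.1 h]
    rw [hnow, hrun]
    -- Sortedness gives one inequality for every request beyond the handled ones; that it is known
    -- at the present time gives the other.
    have hnew : ∀ K : List (Request M), l <+: K → ∀ j r', K.length ≤ j → (DialARide.known σ r.release)[j]? = some r' →
        (r'.release : ℝ) = r.release := by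
      intro K hlK j r' hj hr'
      refine le_antisymm (hle r' (List.mem_of_getElem? hr')) ?_
      have hs : σ[j]? = some r' := by
        obtain ⟨w, hw⟩ := hσ.known_prefix r.release
        rw [← hw, List.getElem?_append_left (List.getElem?_eq_some_iff.1 hr').1, hr']
      have hjl : l.length ≤ j := hlK.length_le.trans hj
      rw [← hl, List.append_assoc, List.getElem?_append_right hjl] at hs
      rcases List.mem_append.1 (List.mem_of_getElem? hs) with h | h
      · rw [List.mem_singleton.1 h]
      · exact hsort' r' h
    rcases ih (l' := r :: l') (by simpa using hl) with rfl | ⟨hP, hi, r₀, hr₀, hr₀'⟩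
    · refine hstep [] _ _ h0 _ (List.nil_prefix) r.release.2 hle ?_ ?_ ⟨r, hmem, rfl⟩
      · exact hnew [] List.nil_prefix
      · intro h
        simp only [List.length_nil, nonpos_iff_eq_zero, List.length_eq_zero_iff] at h
        simp [h] at hmem
    · set L := A.run o c α σ l
      have hnow' : L.now ≤ r.release := by rw [hr₀']; exact hsort r₀ hr₀
      have hpre : DialARide.known σ L.now <+: DialARide.known σ r.release :=
        hσ.known_prefix_known hnow'
      refine hstep _ _ _ hP _ hpre hnow' hle ?_ ?_ ⟨r, hmem, rfl⟩
      -- The handled requests are a prefix of the known ones, perhaps a proper one: simultaneous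
      -- requests become known together but are handled one at a time.
      · refine hnew _ ?_
        have hlk : DialARide.known l L.now = l := by
          rw [DialARide.known, List.filter_eq_self]; simpa using hi
        refine ⟨DialARide.known ([r] ++ l') L.now, ?_⟩
        rw [← hlk]
        conv_rhs => rw [← hl]
        simp only [DialARide.known, List.filter_append, List.append_assoc]
      · intro h
        have := hpre.eq_of_length_le h
        rw [← this] at hmem
        exact le_antisymm hnow' (mem_known.1 hmem).2

theorem Subroutines.run_sound (hA : A.Good ε o c) (hσ : IsRequestSequence σ) (hl : l ++ l' = σ) :
    l = [] ∨ (A.run o c α σ l).Sound o c (DialARide.known σ (A.run o c α σ l).now) ∧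
      (∀ r ∈ l, (r.release : ℝ) ≤ (A.run o c α σ l).now) ∧
      ∃ r ∈ l, (A.run o c α σ l).now = r.release :=
  A.run_induction hσ (LazyState.init_sound o c)
    (fun _ _ _ h _ hK ht hr _ _ _ => h.step hA hK hr ht) hl

theorem Subroutines.filter_run_append (hA : A.Good ε o c) (hσ : IsRequestSequence σ)
    (hl : l ++ l' = σ) (hu : ∀ r ∈ l', u < r.release) :
    (A.run o c α σ σ).route.events.filter (fun e => e.time ≤ u) =
      (A.run o c α σ l).route.events.filter fun e => e.time ≤ u := by
  induction l' generalizing l with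
  | nil => simp [← hl]
  | cons r l' ih =>
    rw [ih (l := l ++ [r]) (by simpa using hl) fun r' hr' => hu r' (by simp [hr'])]
    have hrun : A.run o c α σ (l ++ [r]) = A.step o c α (DialARide.known σ r.release) r.release
        (A.run o c α σ l) := by simp [Subroutines.run]
    have hle : ∀ r' ∈ DialARide.known σ r.release, (r'.release : ℝ) ≤ r.release :=
      fun r' hr' => (mem_known.1 hr').2
    rw [hrun]
    rcases A.run_sound (α := α) hA hσ hl with rfl | ⟨hS, -, r₀, hr₀, hr₀'⟩
    · exact (LazyState.init_sound o c).filter_step hA List.nil_prefix hle r.release.2 (hu r (by simp))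
    · have hnow : (A.run o c α σ l).now ≤ r.release := by
        rw [hr₀']
        subst hl
        exact (List.pairwise_append.1 hσ).2.2 r₀ hr₀ r (by simp)
      exact hS.filter_step hA (hσ.known_prefix_known hnow) hle hnow (hu r (by simp))

theorem Subroutines.path_run_append (hu : ∀ r ∈ l', u < r.release) :
    (A.run o c α σ (l ++ l')).route.path u = (A.run o c α σ l).route.path u := by
  induction l' using List.reverseRecOn with
  | nil => simp
  | append_singleton l' r ih =>
    have hrun : A.run o c α σ (l ++ (l' ++ [r])) =
        A.step o c α (DialARide.known σ r.release) r.release (A.run o c α σ (l ++ l')) := by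
      simp [Subroutines.run]
    rw [hrun, Subroutines.step_route_path (hu r (by simp)).le,
      ih fun r' hr' => hu r' (by simp [hr'])]

/-- A reaction consults only what is known at its own time, so later requests of the ambient
sequence are irrelevant to it. -/
theorem Subroutines.run_known (A : Subroutines M) (σ : List (Request M)) (t : ℝ) :
    A.run o c α σ (DialARide.known σ t) =
      A.run o c α (DialARide.known σ t) (DialARide.known σ t) := by
  refine List.foldl_ext _ _ _ fun L r hr => ?_
  rw [known_known (mem_known.1 hr).2]

/-- Up to time t both runs agree with the run on the common list of known requests: every later
reaction leaves this part of the behaviour alone. -/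
theorem Subroutines.isOnlineAlgorithm (hA : A.Good ε o c) :
    IsOnlineAlgorithm o c (A.algorithm o c α) where
  feasible σ hσ := by
    rcases A.run_sound (l := σ) (l' := []) (α := α) hA hσ (by simp) with rfl | ⟨hS, hle, -⟩
    · exact (LazyState.init_sound o c).route_feasible
    -- All requests have been handled, so the present time is at least every release time.
    · have : DialARide.known σ (A.run o c α σ σ).now = σ := by
        rw [DialARide.known, List.filter_eq_self]; simpa using hle
      rw [this] at hS
      exact hS.route_feasible
  path_eq σ σ' hσ hσ' t h s _ hst := by
    have key : ∀ σ, IsRequestSequence σ → (A.algorithm o c α σ).path s =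
        (A.run o c α (DialARide.known σ t) (DialARide.known σ t)).route.path s := by
      intro σ hσ
      rw [← A.run_known σ t]
      unfold Subroutines.algorithm
      have := Subroutines.path_run_append (A := A) (o := o) (c := c) (α := α) (σ := σ)
        (l := DialARide.known σ t) (l' := σ.filter fun r => t < r.release) (u := s)
        fun r hr => hst.trans_lt (by simpa using (List.mem_filter.1 hr).2)
      rwa [hσ.known_append t] at this
    rw [key σ hσ, key σ' hσ', h]
  events_eq σ σ' hσ hσ' t h := by
    have key : ∀ σ, IsRequestSequence σ →
        (A.algorithm o c α σ).events.filter (fun e => e.time ≤ t) =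
        (A.run o c α (DialARide.known σ t) (DialARide.known σ t)).route.events.filter
          fun e => e.time ≤ t := by
      intro σ hσ
      rw [← A.run_known σ t]
      exact A.filter_run_append hA hσ (hσ.known_append t)
        fun r hr => by simpa using (List.mem_filter.1 hr).2
    rw [key σ hσ, key σ' hσ', h]

end known

end Algorithm

/-! ### Competitive analysis -/

section Analysis

/-- The parameters for which the analysis of the lazy strategy works. -/
structure Admissible (α β ε : ℝ) : Prop where
  half_le : 1 / 2 ≤ β
  sq : α * α = α + β
  four_le : 4 ≤ 3 * α
  two_mul_sq : α + 2 + 4 * ε ≤ 2 * (α * α)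
  nonneg : 0 ≤ ε

section arithmetic

variable {α β ε x w z t s p y n d : ℝ}

/-- The main terms add up to (α+β)x + z = α²x + z ≤ (1+α)z. The errors add up to 4εx + εw; since z ≥
αx ≥ 4x/3, this is at most 3εz + εz. So 4 is a constant that reproduces itself in the induction. The
right side equals (1+α+4ε)z + 2(z-w). -/
theorem Admissible.bound_visited_before (h : Admissible α β ε) (hx : 0 ≤ x)
    (hwz : w ≤ z) (ht : α * x ≤ t) (htz : t ≤ z) (hts : t + s ≤ (1 + α + 4 * ε) * x)
    (hp : (1 - β) * x ≤ p) (hn : n ≤ z - p + ε * w) :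
    t + s + n ≤ (1 + α + 4 * ε) * w + (3 + α + 4 * ε) * (z - w) := by
  have h0 := h.nonneg
  have h1 : α * (α * x) ≤ α * z := mul_le_mul_of_nonneg_left (by linarith) (by linarith [h.four_le])
  have h2 : α * (α * x) = (α + β) * x := by rw [← mul_assoc, h.sq]
  have h3 : 4 * x ≤ 3 * z := by nlinarith [h.four_le]
  have h4 : ε * (4 * x) ≤ ε * (3 * z) := mul_le_mul_of_nonneg_left h3 h0
  have h5 : ε * w ≤ ε * z := mul_le_mul_of_nonneg_left hwz h0
  linarith

/-- The case of a departure at time αw. As 2z - w = w + 2(z-w), it is the case that calls for the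
extra slack 2(z-w). -/
theorem Admissible.bound_wait (h : Admissible α β ε) (hw : 0 ≤ w) (hwz : w ≤ z)
    (hn : n ≤ 2 * z - w + ε * w) :
    α * w + n ≤ (1 + α + 4 * ε) * w + (3 + α + 4 * ε) * (z - w) := by
  have h0 := h.nonneg
  have h1 : 0 ≤ ε * w := mul_nonneg h0 hw
  have h2 : 0 ≤ ε * (z - w) := mul_nonneg h0 (by linarith)
  have h3 : 0 ≤ α * (z - w) := mul_nonneg (by linarith [h.four_le]) (by linarith)
  linarith

/-- Apart from errors the sum is at most (1+α)x + 2z - 2αx ≤ 2z, by α ≥ 1. -/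
theorem Admissible.bound_visited_after (h : Admissible α β ε) (hx : 0 ≤ x) (hw : 0 ≤ w)
    (hwz : w ≤ z) (ht : α * x ≤ t) (htz : t ≤ z) (hts : t + s ≤ (1 + α + 4 * ε) * x)
    (hn : n ≤ 2 * z - 2 * t + ε * w) :
    t + s + n ≤ (1 + α + 4 * ε) * w + (3 + α + 4 * ε) * (z - w) := by
  have h0 := h.nonneg
  have h3 : 4 * x ≤ 3 * z := by nlinarith [h.four_le]
  have h4 : ε * (4 * x) ≤ ε * (3 * z) := mul_le_mul_of_nonneg_left h3 h0
  have h5 : ε * w ≤ ε * z := mul_le_mul_of_nonneg_left hwz h0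
  have h6 : 0 ≤ (α - 1) * x := mul_nonneg (by linarith [h.four_le]) hx
  have h7 : 0 ≤ (α - 1) * z := mul_nonneg (by linarith [h.four_le]) (by linarith)
  linarith

/-- The time y cancels, leaving t + βx + z ≤ 2z + βx up to errors, and βx = (α-1)αx ≤ (α-1)z. -/
theorem Admissible.bound_served_before (h : Admissible α β ε) (hx : 0 ≤ x) (hw : 0 ≤ w)
    (hwz : w ≤ z) (ht : α * x ≤ t) (htz : t ≤ z) (hs : s ≤ y + ε * x)
    (hn : n ≤ (β + ε) * x + (t - y) + (z - t) + ε * w) :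
    t + s + n ≤ (1 + α + 4 * ε) * w + (3 + α + 4 * ε) * (z - w) := by
  have h0 := h.nonneg
  have h3 : 4 * x ≤ 3 * z := by nlinarith [h.four_le]
  have h4 : ε * (4 * x) ≤ ε * (3 * z) := mul_le_mul_of_nonneg_left h3 h0
  have h5 : ε * w ≤ ε * z := mul_le_mul_of_nonneg_left hwz h0
  have h6 : 0 ≤ (α - 1) * (z - α * x) := mul_nonneg (by linarith [h.four_le]) (by linarith)
  have h7 : α * (α * x) = (α + β) * x := by rw [← mul_assoc, h.sq]
  have h8 : 0 ≤ ε * z := mul_nonneg h0 (by linarith)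
  linarith

/-- Here y no longer cancels, but s ≤ x, y ≤ z and t ≥ αx ≥ x again leave 2z + βx up to errors. -/
theorem Admissible.bound_served_after (h : Admissible α β ε) (hx : 0 ≤ x) (hw : 0 ≤ w)
    (hwz : w ≤ z) (ht : α * x ≤ t) (htz : t ≤ z) (hs : s ≤ (1 + ε) * x) (hy : y ≤ z)
    (hn : n ≤ (β + ε) * x + (y - t) + (z - t) + ε * w) :
    t + s + n ≤ (1 + α + 4 * ε) * w + (3 + α + 4 * ε) * (z - w) := by
  have h0 := h.nonneg
  have h3 : 4 * x ≤ 3 * z := by nlinarith [h.four_le]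
  have h4 : ε * (4 * x) ≤ ε * (3 * z) := mul_le_mul_of_nonneg_left h3 h0
  have h5 : ε * w ≤ ε * z := mul_le_mul_of_nonneg_left hwz h0
  have h6 : 0 ≤ (α - 1) * (z - α * x) := mul_nonneg (by linarith [h.four_le]) (by linarith)
  have h7 : α * (α * x) = (α + β) * x := by rw [← mul_assoc, h.sq]
  have h8 : 0 ≤ ε * z := mul_nonneg h0 (by linarith)
  have h9 : 0 ≤ (α - 1) * x := mul_nonneg (by linarith [h.four_le]) hx
  linarith

/-- If the way back starts at y, then αw < (2+α+4ε)x ≤ 2α²x. If it starts at t ≤ w, then (α-1)w ≤ x,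
and multiplying by 2α gives 2βw ≤ 2αx with β ≥ 1/2. -/
theorem Admissible.opt_le_of_far (h : Admissible α β ε) (hx : 0 ≤ x) (htw : t ≤ w)
    (hd : d ≤ x) (hy : y ≤ (1 + α + 4 * ε) * x) (hfar : α * w < max y t + d) :
    w ≤ 2 * α * x := by
  have hα : 0 < α := by linarith [h.four_le]
  rcases max_cases y t with ⟨he, -⟩ | ⟨he, -⟩ <;> rw [he] at hfar
  · have h1 : α * w ≤ α * (2 * α * x) := by
      have := mul_le_mul_of_nonneg_right h.two_mul_sq hx
      linarith
    exact le_of_mul_le_mul_left h1 hα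
  · have h1 : (α - 1) * w ≤ x := by linarith
    have h2 : 2 * α * ((α - 1) * w) ≤ 2 * α * x := mul_le_mul_of_nonneg_left h1 (by linarith)
    have h3 : 2 * α * ((α - 1) * w) = 2 * β * w := by
      have := h.sq
      calc 2 * α * ((α - 1) * w) = 2 * (α * α - α) * w := by ring
        _ = _ := by rw [h.sq]; ring
    by_cases hw : 0 ≤ w
    · nlinarith [h.half_le]
    · have : 0 ≤ 2 * α * x := by positivity
      linarith

end arithmetic

variable {M : Type*} [MetricSpace M] {K K' : List (Request M)} {c : ℕ∞} {o x : M} {α β ε : ℝ}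
  {A : Subroutines M} {st : ℕ → Status M} {L : LazyState M} {t : ℝ}

/-- The space is such that a tour of length at most `(1 + ε) * x` that starts in `o` and ends close
to `o` visits only points that are not too far from its end. -/
def ShortDetour (o : M) (β ε : ℝ) : Prop :=
  ∀ (p q : M) (x : ℝ), 0 ≤ x → dist o q + dist q p ≤ (1 + ε) * x → dist o p ≤ (1 - β) * x →
    dist p q ≤ (β + ε) * x

/-- The server completes a schedule of duration `s`, begun at time `t₀` for the requests of `K₀`
with status `waiting` in `st₀`, and cannot return to the origin before its next departure. -/
structure LazyState.Following (o : M) (c : ℕ∞) (α ε : ℝ) (K : List (Request M)) (L : LazyState M)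
    (K₀ : List (Request M)) (st₀ : ℕ → Status M) (t₀ s : ℝ) : Prop where
  isPrefix : K₀ <+: K
  length_lt : K₀.length < K.length
  endStatus : ∀ j, L.endStatus K j = if j < K₀.length then .delivered else .waiting
  release : ∀ j r, K₀.length ≤ j → K[j]? = some r → t₀ ≤ r.release
  late : α * opt o c K₀ ≤ t₀
  bound : t₀ + s ≤ (1 + α + 4 * ε) * opt o c K₀
  opt_le : opt o c K ≤ 2 * α * opt o c K₀
  dur : L.now + L.cmd.dur ≤ max (t₀ + s) L.now
  status : ∀ j, st₀ j = .waiting ∨ st₀ j = .delivered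
  endpoint : ∃ j r, K₀[j]? = some r ∧ st₀ j = .waiting ∧ L.endPos = r.dst
  origin : ((∀ S : Schedule M, S.Serves K₀ c o st₀ → s ≤ S.dur + ε * opt o c K₀) ∧
      ∀ j r, K₀[j]? = some r → st₀ j = .waiting →
        dist o r.dst + dist r.dst L.endPos ≤ s) ∨
    ∀ j r, K₀[j]? = some r → st₀ j = .waiting → opt o c K₀ ≤ 2 * r.release

/-- The invariant of the lazy strategy. -/
structure LazyState.Invariant (o : M) (c : ℕ∞) (α ε : ℝ) (K : List (Request M))
    (L : LazyState M) : Prop where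
  sound : L.Sound o c K
  now_le : L.now ≤ opt o c K
  start_eq : L.start = max (L.now + L.cmd.dur) (α * opt o c K)
  next_le : ∀ S : Schedule M, S.Serves K c L.endPos (L.endStatus K) →
    L.next.dur ≤ S.dur + ε * opt o c K
  endpoint : K ≠ [] → ∃ j r, K[j]? = some r ∧ L.endStatus K j = .waiting ∧
    L.next.path L.next.dur = r.dst
  empty : K = [] → L.next.path L.next.dur = o ∧ L.start + L.next.dur ≤ 0
  mode : (L.endPos = o ∧ L.now + L.cmd.dur ≤ α * opt o c K) ∨
    ∃ K₀ st₀ t₀ s, L.Following o c α ε K K₀ st₀ t₀ s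

/-- Departing from the origin, the server can imitate any offline solution from its time 0 on. -/
theorem LazyState.Invariant.bound_home (hM : GeodesicSpace M) (hc : 1 ≤ c)
    (hα : Admissible α β ε) (h : L.Invariant o c α ε K) (ho : L.endPos = o)
    (hd : L.now + L.cmd.dur ≤ α * opt o c K) :
    L.start + L.next.dur ≤ (1 + α + 4 * ε) * opt o c K := by
  have hs : L.start = α * opt o c K := by rw [h.start_eq, max_eq_right hd]
  have hε := mul_nonneg hα.nonneg (opt_nonneg (o := o) (c := c) (K := K))
  refine le_of_forall_solves hM hc (o := o) (K := K) one_pos fun O hO => ?_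
  obtain ⟨S, hS, hSd⟩ := hO.exists_serves hM (List.prefix_refl K) h.sound.finished
    le_rfl O.completion_nonneg
    (fun e he _ _ => ⟨hO.1.1.nonneg e he, Route.time_le_completion he⟩) L.endPos
  have := h.next_le S hS
  rw [hSd, ho, hO.1.1.start, dist_self] at this
  linarith

theorem LazyState.Invariant.bound_following (hM : GeodesicSpace M) (hc : 1 ≤ c)
    (hα : Admissible α β ε) (hG : ShortDetour o β ε) (h : L.Invariant o c α ε K)
    {K₀ : List (Request M)} {st₀ : ℕ → Status M} {t₀ s : ℝ}
    (hF : L.Following o c α ε K K₀ st₀ t₀ s) :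
    L.start + L.next.dur ≤ (1 + α + 4 * ε) * opt o c K := by
  have hε := hα.nonneg
  have h4 := hα.four_le
  have hx : 0 ≤ opt o c K₀ := opt_nonneg
  have hw : 0 ≤ opt o c K := opt_nonneg
  -- The optimum need not be attained: a solution with completion time z costs a slack proportional
  -- to z - w, with the coefficient of the arithmetic lemmas.
  refine le_of_forall_solves hM hc (o := o) (K := K) (C := 3 + α + 4 * ε) (by linarith)
    fun O hO => ?_
  set x := opt o c K₀ with hxdef
  set w := opt o c K with hwdef
  set z := O.completion with hz
  have hwz : w ≤ z := opt_le hO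
  have ht₀ : 0 ≤ t₀ := (mul_nonneg (by linarith) hx).trans hF.late
  have ht₀z : t₀ ≤ z := by
    refine le_trans ?_ hwz
    refine (hF.release K₀.length _ le_rfl (List.getElem?_eq_getElem hF.length_lt)).trans ?_
    exact release_le_opt hM hc (List.getElem_mem _)
  -- Everything still open was released at t₀ or later, so the offline server handles it after t₀.
  -- Join it there and imitate it.
  obtain ⟨S, hS, hSd⟩ := hO.exists_serves hM (List.prefix_refl K) h.sound.finished
    ht₀ ht₀z (fun e he hlt hwait => ⟨by
      have hi : K₀.length ≤ e.idx := by
        by_contra hi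
        rw [hF.endStatus, if_pos (by omega)] at hwait
        simp at hwait
      exact (hF.release _ _ hi (List.getElem?_eq_getElem hlt)).trans
        (hO.release_le he (List.getElem?_eq_getElem hlt)), Route.time_le_completion he⟩) L.endPos
  have hn := h.next_le S hS
  rw [hSd] at hn
  obtain ⟨j, r, hr, hj, hp⟩ := hF.endpoint
  have hpre : ∀ {j : ℕ} {r : Request M}, K₀[j]? = some r → K[j]? = some r := by
    intro j r hr
    obtain ⟨u, rfl⟩ := hF.isPrefix
    rw [List.getElem?_append_left (List.getElem?_eq_some_iff.1 hr).1, hr]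
  obtain ⟨e, he, hej, hep, her, hed⟩ := hO.exists_delivery (hpre hr)
  rw [← hp] at hep hed
  have hez : e.time ≤ z := Route.time_le_completion he
  have he0 := hO.1.1.nonneg e he
  have hstart : L.start ≤ max (t₀ + s) (α * w) := by
    have h1 := hF.dur
    have h2 := h.now_le
    have h3 : w ≤ α * w := by nlinarith
    rw [h.start_eq]
    refine max_le (h1.trans (max_le_max le_rfl (h2.trans h3))) (le_max_right _ _)
  suffices hgoal : t₀ + s + L.next.dur ≤
      (1 + α + 4 * ε) * w + (3 + α + 4 * ε) * (z - w) ∧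
      L.next.dur ≤ 2 * z - w + ε * w by
    have h1 := hα.bound_wait hw hwz hgoal.2
    rcases max_cases (t₀ + s) (α * w) with ⟨hm, -⟩ | ⟨hm, -⟩ <;> rw [hm] at hstart <;>
      linarith [hgoal.1]
  -- Converts 2z - 2t₀ into the bound 2z - w needed when the server waits until αw.
  have h2t : w ≤ 2 * t₀ := by linarith [hF.opt_le, hF.late]
  rcases le_total t₀ e.time with hte | hte
  · have hd := hO.dist_le ht₀ hte
    rw [hep, dist_comm] at hd
    have hn' : L.next.dur ≤ 2 * z - 2 * t₀ + ε * w := by linarith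
    exact ⟨hα.bound_visited_after hx hw hwz hF.late ht₀z hF.bound hn', by linarith⟩
  have hd := hO.dist_le he0 hte
  rw [hep] at hd
  have hn' : L.next.dur ≤ z - e.time + ε * w := by linarith
  refine ⟨?_, by linarith⟩
  by_cases hlate : (1 - β) * x ≤ e.time
  · exact hα.bound_visited_before hx hwz hF.late ht₀z hF.bound hlate hn'
  -- If all requests of the running schedule were released at x/2 or later, the end of the schedule
  -- could not be visited as a destination before (1-β)x ≤ x/2.
  have horigin := hF.origin.resolve_right fun hcon => hlate <| by
    have := hcon j r hr hj
    have := mul_le_mul_of_nonneg_right hα.half_le hx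
    linarith
  obtain ⟨hshort, hvisit⟩ := horigin
  -- the last of the earlier requests that the offline solution serves
  have hK₀lt : ∀ {j : ℕ} {r : Request M}, K₀[j]? = some r → j < K₀.length := fun h =>
    (List.getElem?_eq_some_iff.1 h).1
  set I : Set ℕ := {j | j < K₀.length ∧ st₀ j = .waiting} with hI
  obtain ⟨f, hf, hflast, rq, hrq, hfq⟩ := exists_last (σ := K) (path := O.path)
    (st := fun _ => .waiting) (es := restrictTo I O.events)
    (List.ne_nil_of_mem (mem_restrictTo.2 ⟨he, by rw [hej]; exact ⟨hK₀lt hr, hj⟩⟩))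
    (fun e he => by
      have hm := mem_restrictTo.1 he
      rw [statusAfter_restrictTo (st := fun _ => .waiting) (fun _ _ => rfl) hm.2]
      exact hO.serves _ (hO.1.1.legal.idx_lt e hm.1))
    (pairwise_filter_time hO.1.1.sorted)
  obtain ⟨hfO, hfI⟩ := mem_restrictTo.1 hf
  have hf0 := hO.1.1.nonneg f hfO
  have hfz : f.time ≤ z := Route.time_le_completion hfO
  -- The offline solution up to its last event for these requests is a competing schedule from the
  -- origin, whence s ≤ y + εx.
  obtain ⟨S₀, hS₀, hS₀d⟩ := hO.exists_serves hM hF.isPrefix hF.status le_rfl hf0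
    (fun e he hlt hwait => ⟨hO.1.1.nonneg e he, hflast e (mem_restrictTo.2 ⟨he, hlt, hwait⟩)⟩) o
  have hs1 := hshort S₀ hS₀
  rw [hS₀d, hO.1.1.start, dist_self] at hs1
  -- The same comparison with solutions of K₀ alone; it provides the tour length that `ShortDetour`
  -- asks for.
  have hs2 : s ≤ (1 + ε) * x := by
    have : s - ε * x ≤ x := le_opt hM hc fun O' hO' => by
      obtain ⟨S₁, hS₁, hS₁d⟩ := hO'.exists_serves hM (List.prefix_refl K₀) hF.status le_rfl
        O'.completion_nonneg
        (fun e he _ _ => ⟨hO'.1.1.nonneg e he, Route.time_le_completion he⟩) o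
      have := hshort S₁ hS₁
      rw [hS₁d, hO'.1.1.start, dist_self] at this
      linarith
    linarith
  have hrq₀ : K₀[f.idx]? = some rq := by
    obtain ⟨rq', h1⟩ : ∃ rq', K₀[f.idx]? = some rq' := ⟨_, List.getElem?_eq_getElem hfI.1⟩
    rw [h1, ← hpre h1, hrq]
  have hq := hG L.endPos rq.dst x hx ((hvisit _ _ hrq₀ hfI.2).trans hs2) (by linarith)
  rcases le_total f.time t₀ with hft | hft
  · have h1 := hO.dist_le hf0 hft
    rw [hfq] at h1
    have := dist_triangle L.endPos rq.dst (O.path t₀)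
    exact hα.bound_served_before hx hw hwz hF.late ht₀z (y := f.time) (by linarith) (by linarith)
  · have h1 := hO.dist_le ht₀ hft
    rw [hfq, dist_comm] at h1
    have := dist_triangle L.endPos rq.dst (O.path t₀)
    exact hα.bound_served_after hx hw hwz hF.late ht₀z hs2 hfz (by linarith)

theorem LazyState.Invariant.bound (hM : GeodesicSpace M) (hc : 1 ≤ c)
    (hα : Admissible α β ε) (hG : ShortDetour o β ε) (h : L.Invariant o c α ε K) :
    L.start + L.next.dur ≤ (1 + α + 4 * ε) * opt o c K := by
  rcases h.mode with ⟨h1, h2⟩ | ⟨K₀, st₀, t₀, s, hF⟩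
  · exact h.bound_home hM hc hα h1 h2
  · exact h.bound_following hM hc hα hG hF

/-- From a schedule that ends with all loaded requests delivered one obtains a way to deliver the
requests loaded before and to return. -/
theorem Schedule.Valid.exists_returnsHome (hM : GeodesicSpace M) {S : Schedule M}
    (hS : S.Valid K c x st) (o : M)
    (hfin : ∀ j, statusAfter K S.path S.events st j = .waiting ∨
      statusAfter K S.path S.events st j = .delivered) :
    ∃ T : Schedule M, T.ReturnsHome o K c x st ∧ T.dur = S.dur + dist (S.path S.dur) o := by
  set I : Set ℕ := {j | st j ≠ .waiting} with hI
  have hv : Schedule.Valid K c x st ⟨⟨S.path, restrictTo I S.events⟩, S.dur⟩ :=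
    ⟨⟨hS.route.start, hS.route.speed, pairwise_filter_time hS.route.sorted,
      fun e he => hS.route.nonneg e (mem_restrictTo.1 he).1,
      hS.route.legal.restrictTo (fun _ _ => rfl) fun j hj => by
        have : st j = .waiting := by simpa [hI] using hj
        simp [this]⟩,
      hS.dur_nonneg, fun e he => hS.events_le e (mem_restrictTo.1 he).1, hS.still⟩
  obtain ⟨T, hT, hTd, hTe, hTev, hTs⟩ := hv.exists_append_move hM o
  refine ⟨T, ⟨hT, ?_, ?_, hTe⟩, hTd⟩
  · intro e he
    rw [hTev] at he
    exact (mem_restrictTo.1 he).2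
  · intro j _ hj
    rw [hTs]
    show statusAfter K S.path (restrictTo I S.events) st j = _
    rw [statusAfter_restrictTo (fun _ _ => rfl) (show j ∈ I from hj)]
    exact (hfin j).resolve_left (statusAfter_ne_waiting hj)

/-- The server has to pass the destination of each open request on its way to the end of the
schedule. -/
theorem Schedule.Serves.dist_add_dist_le {S : Schedule M} (hS : S.Serves K c o st) {j : ℕ}
    {r : Request M} (hr : K[j]? = some r) (hj : st j = .waiting) :
    dist o r.dst + dist r.dst (S.path S.dur) ≤ S.dur := by
  obtain ⟨e, he, -, r', hr', hp⟩ := DialARide.exists_delivery (st := st) (by simp [hj])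
    (hS.2 j (List.getElem?_eq_some_iff.1 hr).1)
  obtain rfl : r = r' := by simpa [hr] using hr'
  have h0 := hS.1.route.nonneg e he
  have h1 := hS.1.route.speed 0 e.time le_rfl h0
  have h2 := hS.1.route.speed e.time S.dur h0 hS.1.dur_nonneg
  rw [hS.1.route.start, hp, zero_sub, abs_neg, abs_of_nonneg h0] at h1
  rw [hp, abs_sub_comm, abs_of_nonneg (by linarith [hS.1.events_le e he])] at h2
  linarith

/-- A granted return yields the first mode. A refusal during the old command keeps the earlier K₀; a
refusal during the planned schedule makes K the new K₀, with the bound for K as the induction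
hypothesis on its end. -/
theorem LazyState.Invariant.step (hM : GeodesicSpace M) (hc : 1 ≤ c) (hA : A.Good ε o c)
    (hα : Admissible α β ε) (hG : ShortDetour o β ε) (h : L.Invariant o c α ε K) (hK : K <+: K')
    (ht : L.now ≤ t) (hr : ∀ r ∈ K', (r.release : ℝ) ≤ t)
    (hnew : ∀ j r, K.length ≤ j → K'[j]? = some r → (r.release : ℝ) = t)
    (heq : K'.length ≤ K.length → L.now = t) (hmem : ∃ r ∈ K', (r.release : ℝ) = t) :
    (A.step o c α K' t L).Invariant o c α ε K' := by
  have h4 := hα.four_le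
  have hSound : (A.step o c α K' t L).Sound o c K' := h.sound.step hA hK hr ht
  have htw : t ≤ opt o c K' := by
    obtain ⟨r, hrK, rfl⟩ := hmem
    exact release_le_opt hM hc hrK
  have hne : K' ≠ [] := by
    obtain ⟨r, hr, -⟩ := hmem
    exact List.ne_nil_of_mem hr
  have hw0 : 0 ≤ opt o c K' := opt_nonneg
  have hmono : opt o c K ≤ opt o c K' := opt_mono hM hc hK
  have hw1 : opt o c K' ≤ α * opt o c K' := by nlinarith
  set L' := A.step o c α K' t L with hL'
  have hst : L'.status K' = statusAfter K (L.pastAt t).path (L.pastAt t).events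
      fun _ => .waiting := h.sound.statusAfter_pastAt_extend hK t
  have hcmd : L'.cmd = (A.home K' ((L.current t).path 0) (L'.status K') t
    (α * opt o c K')).getD (L.current t) := rfl
  have hcur := h.sound.current_valid ht
  rw [← hst] at hcur
  have key : ((∃ j < K'.length, L'.endStatus K' j = .waiting) ∧
      ((L'.endPos = o ∧ L'.now + L'.cmd.dur ≤ α * opt o c K') ∨
      ∃ K₀ st₀ t₀ s, L'.Following o c α ε K' K₀ st₀ t₀ s)) := by
    cases hh : A.home K' ((L.current t).path 0) (L'.status K') t (α * opt o c K') with
    | some S =>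
      rw [hh, Option.getD_some] at hcmd
      obtain ⟨hS, hSd⟩ := hA.home_some _ _ _ _ _ _ hh
      refine ⟨?_, .inl ⟨?_, ?_⟩⟩
      -- Either a new request has arrived, or the call repeats one for the same time. In the latter
      -- case the old invariant supplies a request that waits at the end of the command, and waiting
      -- is never regained.
      · have hex : ∃ j < K'.length, L'.status K' j = .waiting := by
          rw [hst]
          rcases lt_or_ge K.length K'.length with hlt | hge
          · exact ⟨K.length, hlt, h.sound.pastAt_waiting t le_rfl⟩
          · obtain rfl := hK.eq_of_length_le hge
            obtain ⟨j, r, hr, hj, -⟩ := h.endpoint hne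
            refine ⟨j, (List.getElem?_eq_some_iff.1 hr).1, ?_⟩
            by_contra hcon
            rw [← h.sound.current_statusAfter_of_le
              ((heq hge).symm.le.trans h.sound.now_le_start)] at hj
            exact statusAfter_ne_waiting hcon hj
        obtain ⟨j, hj, hjw⟩ := hex
        refine ⟨j, hj, ?_⟩
        have := hS.statusAfter (fun i hi => by
          rw [hst]; exact h.sound.pastAt_waiting t (hK.length_le.trans hi)) j
        unfold LazyState.endStatus
        rw [hcmd]
        tauto
      · unfold LazyState.endPos
        rw [hcmd]; exact hS.2.2.2
      · rw [hcmd]; exact hSd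
    | none =>
      rw [hh, Option.getD_none] at hcmd
      have hst' : L'.endStatus K' = statusAfter K (L.current t).path (L.current t).events
          (L'.status K') := by
        unfold LazyState.endStatus
        rw [hcmd, hcur.route.legal.statusAfter_extend hK]
      have hend : L'.endPos = (L.current t).path (L.current t).dur := by
        unfold LazyState.endPos; rw [hcmd]
      -- Carrying out the running command without its waiting requests and then walking home is an
      -- admissible return, so it must miss the deadline.
      have hfar : α * opt o c K' <
          t + (L.current t).dur + dist ((L.current t).path (L.current t).dur) o := by
        obtain ⟨T, hT, hTd⟩ := (hcur.extend hK).exists_returnsHome hM o (fun j => by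
          rw [hcur.route.legal.statusAfter_extend hK, hst]
          exact h.sound.current_finished j)
        have := hA.home_none _ _ _ _ _ hh T hT
        rw [hTd] at this
        linarith
      suffices hF : ∃ K₀ st₀ t₀ s, L'.Following o c α ε K' K₀ st₀ t₀ s by
        obtain ⟨K₀, st₀, t₀, s, hF⟩ := hF
        exact ⟨⟨K₀.length, hF.length_lt, by rw [hF.endStatus, if_neg (lt_irrefl _)]⟩,
          .inr ⟨K₀, st₀, t₀, s, hF⟩⟩
      rcases le_or_gt t L.start with hts | hts
      · rw [h.sound.add_current_dur_of_le hts, h.sound.current_end_of_le hts] at hfar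
        rw [h.sound.current_end_of_le hts] at hend
        rw [hst, h.sound.current_statusAfter_of_le hts] at hst'
        rcases h.mode with ⟨h1, h2⟩ | ⟨K₀, st₀, t₀, s, hF⟩
        -- The command already ended in the origin in time, and the deadline has only grown.
        · exfalso
          rw [h1, dist_self, add_zero] at hfar
          have : α * opt o c K ≤ α * opt o c K' := mul_le_mul_of_nonneg_left hmono (by linarith)
          exact absurd hfar (not_lt.2 (max_le (h2.trans this) (htw.trans hw1)))
        · have hdur : max (L.now + L.cmd.dur) t ≤ max (t₀ + s) t :=
            max_le (hF.dur.trans (max_le_max le_rfl ht)) (le_max_right _ _)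
          have hx : dist L.endPos o ≤ opt o c K₀ := by
            obtain ⟨j, r, hj, -, hp⟩ := hF.endpoint
            rw [hp, dist_comm]
            exact dist_dst_le_opt hM hc (List.mem_of_getElem? hj)
          have ht₀ : t₀ ≤ t := by
            have h1 := List.getElem?_eq_getElem hF.length_lt
            exact (hF.release _ _ le_rfl h1).trans
              ((h.sound.release_le _ (List.mem_of_getElem? h1)).trans ht)
          refine ⟨K₀, st₀, t₀, s, hF.isPrefix.trans hK, hF.length_lt.trans_le hK.length_le,
            ?_, ?_, hF.late, hF.bound, ?_, ?_, hF.status, ?_, ?_⟩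
          · intro j; rw [hst', hF.endStatus]
          · intro j r hj hjr
            rcases lt_or_ge j K.length with hjK | hjK
            · refine hF.release j r hj ?_
              obtain ⟨u, rfl⟩ := hK
              rwa [List.getElem?_append_left hjK] at hjr
            · rw [hnew j r hjK hjr]; exact ht₀
          · exact hα.opt_le_of_far opt_nonneg htw hx hF.bound
              (hfar.trans_le (add_le_add_left hdur _))
          · show t + L'.cmd.dur ≤ max (t₀ + s) t
            rw [hcmd, h.sound.add_current_dur_of_le hts]
            exact hdur
          · rw [hend]; exact hF.endpoint
          · rw [hend]; exact hF.origin
      · rw [h.sound.add_current_dur_of_lt hts, h.sound.current_end_of_lt hts] at hfar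
        rw [h.sound.current_end_of_lt hts] at hend
        rw [hst, h.sound.current_statusAfter_of_lt hts] at hst'
        -- Before the first request the server rests in the origin, so a return cannot have been
        -- refused.
        by_cases hKe : K = []
        · exfalso
          obtain ⟨h1, h2⟩ := h.empty hKe
          rw [h1, dist_self, add_zero] at hfar
          exact absurd hfar (not_lt.2 (max_le (by linarith) (by linarith)))
        obtain ⟨j₀, r₀, hr₀, hj₀, hp₀⟩ := h.endpoint hKe
        have hbound := h.bound hM hc hα hG
        refine ⟨K, L.endStatus K, L.start, L.next.dur, hK, ?_, ?_, ?_, ?_, hbound, ?_, ?_,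
          h.sound.finished, ?_, ?_⟩
        · by_contra hle
          have := heq (by omega)
          linarith [h.sound.now_le_start]
        · intro j; rw [hst', h.sound.next_statusAfter]
        · intro j r hj hjr
          rw [hnew j r hj hjr]; exact hts.le
        · rw [h.start_eq]; exact le_max_right _ _
        · refine hα.opt_le_of_far opt_nonneg htw ?_ hbound hfar
          rw [hp₀, dist_comm]
          exact dist_dst_le_opt hM hc (List.mem_of_getElem? hr₀)
        · show t + L'.cmd.dur ≤ _
          rw [hcmd, h.sound.add_current_dur_of_lt hts]
          exact le_rfl
        · exact ⟨j₀, r₀, hr₀, hj₀, by rw [hend, hp₀]⟩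
        · rw [hend]
          rcases h.mode with ⟨h1, h2⟩ | ⟨K₀, st₀, t₀, s, hF⟩
          · left
            have hn := h.sound.next
            have hle := h.next_le
            rw [h1] at hn hle
            exact ⟨hle, fun j r hr hj => hn.dist_add_dist_le hr hj⟩
          -- The requests of the planned schedule arrived at or after t₀ ≥ αx, while the optimum of
          -- K is at most 2αx.
          · right
            intro j r hr hj
            have hjK : K₀.length ≤ j := by
              by_contra hcon
              rw [hF.endStatus, if_pos (by omega)] at hj
              simp at hj
            have := hF.release j r hjK hr
            linarith [hF.late, hF.opt_le]
  refine ⟨hSound, htw, rfl, hA.le _ _ _ hSound.finished, fun _ => ?_, fun h => absurd h hne, key.2⟩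
  exact hA.endpoint _ _ _ hSound.finished key.1

theorem LazyState.init_invariant (o : M) (c : ℕ∞) (α ε : ℝ) :
    (LazyState.init o).Invariant o c α ε [] := by
  have h0 : opt o c [] = 0 := by
    refine le_antisymm ?_ opt_nonneg
    have : (LazyState.init o).route.Solves o c [] :=
      ⟨(LazyState.init_sound o c).route_feasible, by intro j hj; simp at hj⟩
    refine (opt_le this).trans (Route.completion_le le_rfl ?_)
    simp [LazyState.route, LazyState.init, delay]
  refine ⟨LazyState.init_sound o c, opt_nonneg, ?_, fun S hS => ?_, by simp, fun _ => ⟨rfl, ?_⟩,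
    .inl ⟨rfl, ?_⟩⟩
  · simp [LazyState.init, h0]
  · rw [h0]
    simpa [LazyState.init] using hS.1.dur_nonneg
  · simp [LazyState.init]
  · simp [LazyState.init, h0]

theorem Subroutines.isCompetitive (hM : GeodesicSpace M) (hc : 1 ≤ c) (hA : A.Good ε o c)
    (hα : Admissible α β ε) (hG : ShortDetour o β ε) :
    IsCompetitive o c (1 + α + 4 * ε) (A.algorithm o c α) := by
  intro σ hσ
  rcases A.run_induction (l := σ) (l' := []) (α := α) (o := o) (c := c)
    (P := fun K L => L.Invariant o c α ε K) hσ (LazyState.init_invariant o c α ε)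
    (fun K L t h K' hK ht hr hnew heq hmem => h.step hM hc hA hα hG hK ht hr hnew heq hmem)
    (by simp) with rfl | ⟨hI, hle, -⟩
  · have h := LazyState.init_sound o c
    refine ⟨h.route_serves, h.completion_le.trans ?_⟩
    have := (LazyState.init_invariant o c α ε).bound hM hc hα hG
    exact this
  · have : known σ (A.run o c α σ σ).now = σ := by
      rw [known, List.filter_eq_self]; simpa using hle
    rw [this] at hI
    exact ⟨hI.sound.route_serves, hI.sound.completion_le.trans (hI.bound hM hc hα hG)⟩

end Analysis

/-! ### Optimal and nearly optimal subroutines -/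

section Choices

variable {M : Type*} [MetricSpace M] {σ K : List (Request M)} {c : ℕ∞} {o x : M} {ε α : ℝ}
  {st : ℕ → Status M}

/-- A schedule can be cut off when the last request is served. -/
theorem Schedule.Serves.exists_cut {S : Schedule M} (hS : S.Serves σ c x st)
    (hw : ∃ j < σ.length, st j = .waiting) :
    ∃ b, 0 ≤ b ∧ b ≤ S.dur ∧ (S.segment 0 b S.events).Serves σ c x st ∧
      ∃ j r, σ[j]? = some r ∧ st j ≠ .delivered ∧ S.path b = r.dst := by
  obtain ⟨j, hj, hjw⟩ := hw
  obtain ⟨e, he, -⟩ := exists_delivery (st := st) (by simp [hjw]) (hS.2 j hj)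
  obtain ⟨f, hf, hlast, r, hr, hp⟩ := exists_last (σ := σ) (path := S.path) (st := st)
    (List.ne_nil_of_mem he) (fun e he => hS.2 _ (hS.1.route.legal.idx_lt e he)) hS.1.route.sorted
  have h0 := hS.1.route.nonneg f hf
  have htime : ∀ e ∈ S.events, 0 ≤ e.time ∧ e.time ≤ f.time := fun e he =>
    ⟨hS.1.route.nonneg e he, hlast e he⟩
  refine ⟨f.time, h0, hS.1.events_le f hf, ⟨?_, ?_⟩, f.idx, r, hr, fun hd => ?_, hp⟩
  · have := Route.segment_valid hS.1.route.speed le_rfl h0 hS.1.route.sorted htime hS.1.route.legal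
    rwa [hS.1.route.start] at this
  · intro j hj
    show statusAfter σ (S.segment 0 f.time S.events).path (S.segment 0 f.time S.events).events st j
      = _
    rw [Route.segment_statusAfter htime]
    exact hS.2 j hj
  · exact hS.1.route.legal.idx_ne_of_delivered hd f hf rfl

/-- Cutting at the last delivery cannot shorten a shortest schedule, so it ends exactly there. -/
theorem Schedule.Serves.end_of_shortest {S : Schedule M} (hS : S.Serves σ c x st)
    (hmin : ∀ S' : Schedule M, S'.Serves σ c x st → S.dur ≤ S'.dur)
    (hst : ∀ j, st j = .waiting ∨ st j = .delivered)
    (hw : ∃ j < σ.length, st j = .waiting) :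
    ∃ j r, σ[j]? = some r ∧ st j = .waiting ∧ S.path S.dur = r.dst := by
  obtain ⟨b, hb0, hb, hs, j, r, hr, hj, hp⟩ := hS.exists_cut hw
  have h1 : S.dur ≤ b - 0 := hmin _ hs
  obtain rfl : b = S.dur := le_antisymm hb (by linarith)
  exact ⟨j, r, hr, (hst j).resolve_right hj, hp⟩

open Classical in
/-- The subroutines given by a choice of optimal sub-schedules. -/
def OptimalSubschedules.subroutines (C : OptimalSubschedules o c) : Subroutines M where
  serve := C.serve
  home K x st t T := if ∃ S : Schedule M, S.ReturnsHome o K c x st ∧ t + S.dur ≤ T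
    then some (C.home K x st) else none

theorem OptimalSubschedules.good (C : OptimalSubschedules o c) (hM : GeodesicSpace M)
    (hc : 1 ≤ c) : C.subroutines.Good 0 o c where
  serves σ x st hst := (C.serve_shortest σ x st hst (exists_serves hM hc σ x hst)).1
  le σ x st hst S hS := by
    rw [zero_mul, add_zero]
    exact (C.serve_shortest σ x st hst ⟨S, hS⟩).2 S hS
  endpoint σ x st hst hw := by
    obtain ⟨h1, h2⟩ := C.serve_shortest σ x st hst (exists_serves hM hc σ x hst)
    exact h1.end_of_shortest h2 hst hw
  home_some σ x st t T S h := by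
    simp only [OptimalSubschedules.subroutines] at h
    split_ifs at h with hex
    obtain ⟨S', hS', hT⟩ := hex
    obtain ⟨h1, h2⟩ := C.home_shortest σ x st ⟨S', hS'⟩
    obtain rfl : C.home σ x st = S := by simpa using h
    exact ⟨h1, by linarith [h2 S' hS']⟩
  home_none σ x st t T h S hS := by
    simp only [OptimalSubschedules.subroutines] at h
    split_ifs at h with hex
    by_contra hcon
    exact hex ⟨S, hS, not_lt.1 hcon⟩

/-- The test for a timely return becomes the choice between `some` and `none`; the general analysis
then applies with ε = 0. -/
theorem OptimalSubschedules.lazy_eq (C : OptimalSubschedules o c) (α : ℝ) :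
    lazy α C = C.subroutines.algorithm o c α := by
  funext σ
  unfold lazy Subroutines.algorithm Subroutines.run
  congr 2
  funext L r
  unfold LazyState.step Subroutines.step
  have : ∀ (p : Prop) [Decidable p] (a b : Schedule M),
      (if p then some a else none).getD b = if p then a else b := by
    intro p _ a b; split_ifs <;> rfl
  simp only [OptimalSubschedules.subroutines, this]

theorem exists_nearly_optimal (hM : GeodesicSpace M) (hc : 1 ≤ c) (hε : 0 < ε) (o : M)
    (σ : List (Request M)) (x : M) (hst : ∀ j, st j = .waiting ∨ st j = .delivered) :
    ∃ S : Schedule M, S.Serves σ c x st ∧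
      (∀ S' : Schedule M, S'.Serves σ c x st → S.dur ≤ S'.dur + ε * opt o c σ) ∧
      ((∃ j < σ.length, st j = .waiting) →
        ∃ j r, σ[j]? = some r ∧ st j = .waiting ∧ S.path S.dur = r.dst) := by
  have hεo : 0 ≤ ε * opt o c σ := mul_nonneg hε.le opt_nonneg
  by_cases hw : ∃ j < σ.length, st j = .waiting
  swap
  · have hd : ∀ j < σ.length, st j = .delivered := fun j hj =>
      (hst j).resolve_left fun h => hw ⟨j, hj, h⟩
    exact ⟨Schedule.stay x 0, ⟨Schedule.stay_valid le_rfl, hd⟩,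
      fun S' hS' => add_nonneg hS'.1.dur_nonneg hεo, fun h => absurd h hw⟩
  -- For optimum 0 the permitted error vanishes, but then all requests lie in the origin and walking
  -- there is exactly optimal. For a positive optimum the error leaves room above the infimum.
  rcases (opt_nonneg (o := o) (c := c) (K := σ)).eq_or_lt with h0 | hpos
  · have hall : ∀ j r, σ[j]? = some r → st j = .waiting → r.src = o ∧ r.dst = o := by
      intro j r hr _
      have h1 := dist_src_le_opt (o := o) hM hc (List.mem_of_getElem? hr)
      have h2 := dist_dst_le_opt (o := o) hM hc (List.mem_of_getElem? hr)
      rw [← h0] at h1 h2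
      exact ⟨(dist_le_zero.1 h1).symm, (dist_le_zero.1 h2).symm⟩
    obtain ⟨S, hS, hSd⟩ := exists_serves_of_eq hM hc x hst hall
    have hmin : ∀ S' : Schedule M, S'.Serves σ c x st → S.dur ≤ S'.dur := by
      intro S' hS'
      obtain ⟨j, hj, hjw⟩ := hw
      have hr : σ[j]? = some σ[j] := List.getElem?_eq_getElem hj
      have := hS'.dist_add_dist_le hr hjw
      rw [(hall j _ hr hjw).2] at this
      rw [hSd]
      linarith [dist_nonneg (x := o) (y := S'.path S'.dur)]
    exact ⟨S, hS, fun S' hS' => (hmin S' hS').trans (le_add_of_nonneg_right hεo),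
      hS.end_of_shortest hmin hst⟩
  · set D : Set ℝ := {d | ∃ S : Schedule M, S.Serves σ c x st ∧ S.dur = d} with hD
    have hbdd : BddBelow D := ⟨0, by rintro d ⟨S, hS, rfl⟩; exact hS.1.dur_nonneg⟩
    have hne : D.Nonempty := by
      obtain ⟨S, hS⟩ := exists_serves hM hc σ x hst
      exact ⟨_, S, hS, rfl⟩
    obtain ⟨d, ⟨S, hS, rfl⟩, hd⟩ := Real.lt_sInf_add_pos hne (mul_pos hε hpos)
    obtain ⟨b, hb0, hb, hs, j, r, hr, hj, hp⟩ := hS.exists_cut hw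
    refine ⟨_, hs, fun S' hS' => ?_, fun _ => ⟨j, r, hr, (hst j).resolve_right hj, ?_⟩⟩
    · have h1 : sInf D ≤ S'.dur := csInf_le hbdd ⟨S', hS', rfl⟩
      show b - 0 ≤ _
      linarith
    · rw [Route.segment_end hb0, hp]

/-- A return need not be fastest; any one that meets the deadline will do, so no optimal choice is
needed. -/
theorem exists_good_subroutines (hM : GeodesicSpace M) (hc : 1 ≤ c) (hε : 0 < ε) (o : M) :
    ∃ A : Subroutines M, A.Good ε o c := by
  classical
  have hserve : ∀ (σ : List (Request M)) (x : M) (st : ℕ → Status M), ∃ S : Schedule M,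
      (∀ j, st j = .waiting ∨ st j = .delivered) → S.Serves σ c x st ∧
      (∀ S' : Schedule M, S'.Serves σ c x st → S.dur ≤ S'.dur + ε * opt o c σ) ∧
      ((∃ j < σ.length, st j = .waiting) →
        ∃ j r, σ[j]? = some r ∧ st j = .waiting ∧ S.path S.dur = r.dst) := by
    intro σ x st
    by_cases hst : ∀ j, st j = .waiting ∨ st j = .delivered
    · obtain ⟨S, hS⟩ := exists_nearly_optimal hM hc hε o σ x hst
      exact ⟨S, fun _ => hS⟩
    · exact ⟨Schedule.stay x 0, fun h => absurd h hst⟩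
  choose serve hserve using hserve
  refine ⟨⟨serve, fun σ x st t T =>
    if h : ∃ S : Schedule M, S.ReturnsHome o σ c x st ∧ t + S.dur ≤ T then some h.choose else none⟩,
    fun σ x st hst => (hserve σ x st hst).1, fun σ x st hst => (hserve σ x st hst).2.1,
    fun σ x st hst => (hserve σ x st hst).2.2, ?_, ?_⟩
  · intro σ x st t T S h
    simp only at h
    split_ifs at h with hex
    obtain rfl : hex.choose = S := by simpa using h
    exact hex.choose_spec
  · intro σ x st t T h S hS
    simp only at h
    split_ifs at h with hex
    by_contra hcon
    exact hex ⟨S, hS, not_lt.1 hcon⟩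

end Choices

/-! ### The parameters of the two cases -/

/-- Adding d(p,q) to both sides of d(p,q) ≤ d(p,o) + d(o,q) gives 2d(p,q) ≤ (1-β)x + (1+ε)x. The
value 2/3 solves 1 - β/2 = β. -/
theorem shortDetour {M : Type*} [MetricSpace M] (o : M) {ε : ℝ} (hε : 0 ≤ ε) :
    ShortDetour o (2 / 3) ε := by
  intro p q x hx h1 h2
  have h3 := dist_triangle p o q
  have h4 := dist_comm q p
  have h5 := dist_comm p o
  have h6 := mul_nonneg hε hx
  linarith

/-- The root of α² = α + 2/3. The limit 1/6 on ε is where α + 2 + 4ε ≤ 2α² still has room. -/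
theorem admissible_general {ε : ℝ} (h0 : 0 ≤ ε) (h1 : ε ≤ 1 / 6) :
    Admissible (1 / 2 + Real.sqrt (11 / 12)) (2 / 3) ε := by
  have hs : Real.sqrt (11 / 12) * Real.sqrt (11 / 12) = 11 / 12 :=
    Real.mul_self_sqrt (by norm_num)
  have hl : 5 / 6 ≤ Real.sqrt (11 / 12) := Real.le_sqrt_of_sq_le (by norm_num)
  refine ⟨by norm_num, ?_, ?_, ?_, h0⟩ <;> nlinarith

theorem admissible_halfLine : Admissible ((1 + Real.sqrt 3) / 2) (1 / 2) 0 := by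
  have hs : Real.sqrt 3 * Real.sqrt 3 = 3 := Real.mul_self_sqrt (by norm_num)
  have hl : 5 / 3 ≤ Real.sqrt 3 := Real.le_sqrt_of_sq_le (by norm_num)
  refine ⟨by norm_num, ?_, ?_, ?_, le_rfl⟩ <;> nlinarith

/-- If q lies below p, the distance is at most p ≤ x/2. Otherwise 2(q-p) ≤ q + (q-p) ≤ x. -/
theorem shortDetour_halfLine : ShortDetour (0 : ℝ≥0) (1 / 2) 0 := by
  intro p q x hx h1 h2
  simp only [NNReal.dist_eq, NNReal.coe_zero, zero_sub, abs_neg, NNReal.abs_eq] at h1 h2 ⊢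
  have hp := p.2
  have hq := q.2
  rcases abs_cases ((p : ℝ) - q) with ⟨h, -⟩ | ⟨h, -⟩ <;> rw [h]
  · linarith
  · have := abs_sub_comm (p : ℝ) q
    rw [← this, h] at h1
    linarith

/-! ### Schedules as tours through their stops -/

section Tours

variable {M : Type*} [MetricSpace M] {x y : M} {l l' : List M}

/-- The length of the tour that starts in `x` and visits the given points in this order. -/
def tour : M → List M → ℝ
  | _, [] => 0
  | x, y :: l => dist x y + tour y l

@[simp] theorem tour_nil : tour x [] = 0 := rfl

@[simp] theorem tour_cons : tour x (y :: l) = dist x y + tour y l := rfl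

theorem tour_le_dist_add (x y : M) (l : List M) : tour x l ≤ dist x y + tour y l := by
  cases l with
  | nil => simp
  | cons z l =>
    rw [tour_cons, tour_cons]
    linarith [dist_triangle x y z]

/-- Skipping stops is no detour. This pays for dropping superfluous events and an unneeded final
stop. -/
theorem tour_le_of_sublist (h : l'.Sublist l) (x : M) : tour x l' ≤ tour x l := by
  induction h generalizing x with
  | slnil => exact le_rfl
  | cons y _ ih => exact (ih x).trans (tour_le_dist_add x y _)
  | cons_cons y _ ih => simpa using ih y

theorem tour_mem_closure {P : Set M} (hx : x ∈ P) (hl : ∀ y ∈ l, y ∈ P) :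
    tour x l ∈ AddSubmonoid.closure ((fun p : M × M => dist p.1 p.2) '' P ×ˢ P) := by
  induction l generalizing x with
  | nil => exact zero_mem _
  | cons y l ih =>
    have hy := hl y (by simp)
    exact add_mem (AddSubmonoid.subset_closure ⟨(x, y), ⟨hx, hy⟩, rfl⟩)
      (ih hy fun z hz => hl z (by simp [hz]))

variable {σ : List (Request M)} {c : ℕ∞} {path : ℝ → M} {st st' : ℕ → Status M}
  {es : List Event} {R : Route M} {o : M}

theorem tour_events_le (hR : ∀ s t : ℝ, 0 ≤ s → 0 ≤ t → dist (R.path s) (R.path t) ≤ |s - t|)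
    {a b : ℝ} (ha : 0 ≤ a) (hab : a ≤ b) (hs : es.Pairwise fun e e' => e.time ≤ e'.time)
    (h : ∀ e ∈ es, a ≤ e.time ∧ e.time ≤ b) :
    tour (R.path a) ((es.map fun e => R.path e.time) ++ [R.path b]) ≤ b - a := by
  have hd : ∀ {s t : ℝ}, 0 ≤ s → s ≤ t → dist (R.path s) (R.path t) ≤ t - s := by
    intro s t hs hst
    have := hR s t hs (hs.trans hst)
    rwa [abs_sub_comm, abs_of_nonneg (by linarith)] at this
  induction es generalizing a with
  | nil => simpa using hd ha hab
  | cons e es ih =>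
    rw [List.pairwise_cons] at hs
    obtain ⟨h1, h2⟩ := h e (by simp)
    have := ih (ha.trans h1) h2 hs.2 fun f hf => ⟨hs.1 f hf, (h f (by simp [hf])).2⟩
    have := hd ha h1
    simp only [List.map_cons, List.cons_append, tour_cons]
    linarith

/-- A legal list of events can be executed by travelling on shortest paths. -/
theorem LegalFrom.exists_schedule (hM : GeodesicSpace M) (h : LegalFrom σ c path st es) (x : M)
    {tl : List M} (htl : tl = [] ∨ tl = [o]) :
    ∃ S : Schedule M, S.Valid σ c x st ∧
      S.dur = tour x ((es.map fun e => path e.time) ++ tl) ∧ (tl = [o] → S.path S.dur = o) ∧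
      (∀ f ∈ S.events, ∃ e ∈ es, e.idx = f.idx) ∧
      statusAfter σ S.path S.events st = statusAfter σ path es st := by
  induction es generalizing st x with
  | nil =>
    rcases htl with rfl | rfl
    · exact ⟨Schedule.stay x 0, Schedule.stay_valid le_rfl, rfl, by simp, by simp [Schedule.stay],
        rfl⟩
    · obtain ⟨S, h1, h2, h3, h4⟩ := hM.exists_move x o
      exact ⟨S, h4 _ _ _, by simp [h2], fun _ => h3, by simp [h1], by simp [h1]⟩
  | cons e es ih =>
    rw [legalFrom_cons] at h
    obtain ⟨S, hS, hSd, hSe, hSev, hSs⟩ := ih h.2 (path e.time)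
    have hsim : e.Similar σ σ path (fun _ => path e.time) ⟨0, e.idx, e.isLoad⟩ :=
      ⟨rfl, rfl, rfl, rfl⟩
    have hA : (Schedule.act (path e.time) e.idx e.isLoad).Valid σ c (path e.time) st :=
      Schedule.act_valid (hsim.legal_iff.2 h.1)
    have hAs : statusAfter σ (Schedule.act (path e.time) e.idx e.isLoad).path
        (Schedule.act (path e.time) e.idx e.isLoad).events st = e.apply σ path st :=
      hsim.apply_eq
    have hS' : S.Valid σ c ((Schedule.act (path e.time) e.idx e.isLoad).path
        (Schedule.act (path e.time) e.idx e.isLoad).dur)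
        (statusAfter σ (Schedule.act (path e.time) e.idx e.isLoad).path
        (Schedule.act (path e.time) e.idx e.isLoad).events st) := by
      rw [hAs]; exact hS
    obtain ⟨T, hT, hTd, hTe, hTev, hTs⟩ := (hA.append hS').exists_move_append hM x
    refine ⟨T, hT, ?_, fun ht => ?_, ?_, ?_⟩
    · rw [hTd]
      show _ + ((0 : ℝ) + S.dur) = _
      rw [hSd, zero_add]; rfl
    · rw [hTe, Schedule.append_end hS'.route.start hS'.dur_nonneg, hSe ht]
    · intro f hf
      obtain ⟨g, hg, hgf⟩ := hTev f hf
      rcases List.mem_append.1 hg with hg | hg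
      · refine ⟨e, by simp, ?_⟩
        have : g = ⟨0, e.idx, e.isLoad⟩ := List.mem_singleton.1 hg
        rw [← hgf, this]
      · obtain ⟨g', hg', rfl⟩ := mem_delay.1 hg
        obtain ⟨e', he', hee⟩ := hSev g' hg'
        exact ⟨e', by simp [he'], hee.trans hgf⟩
    · rw [hTs, Schedule.statusAfter_append hA hS', hAs, hSs]
      rfl

/-- Apply a map to the place where a request is parked. -/
def Status.map (φ : M → M) : Status M → Status M
  | .parked x => .parked (φ x)
  | s => s

theorem Status.map_eq_carried {φ : M → M} {s : Status M} : s.map φ = .carried ↔ s = .carried := by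
  cases s <;> simp [Status.map]

/-- The statuses `st'` arise from `st` by moving the parked requests, except that some of them may
be served already. -/
def MovedBy (σ : List (Request M)) (φ : M → M) (st st' : ℕ → Status M) : Prop :=
  ∀ j, st' j = .delivered ∨ st' j = (st j).map φ ∨ σ.length ≤ j ∧ st' j = st j

theorem MovedBy.delivered {φ : M → M} (h : MovedBy σ φ st st') {j : ℕ} (hj : st j = .delivered) :
    st' j = .delivered := by
  rcases h j with h | h | ⟨-, h⟩
  · exact h
  · rw [h, hj]; rfl
  · rw [h, hj]

/-- All events can be moved by a map that fixes the starting positions and destinations. -/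
theorem LegalFrom.exists_moved {φ : M → M} (hφ : ∀ r ∈ σ, φ r.src = r.src ∧ φ r.dst = r.dst)
    (h : LegalFrom σ c path st es) (hm : MovedBy σ φ st st') :
    ∃ es', es'.Sublist es ∧ LegalFrom σ c (φ ∘ path) st' es' ∧
      MovedBy σ φ (statusAfter σ path es st) (statusAfter σ (φ ∘ path) es' st') := by
  induction es generalizing st st' with
  | nil => exact ⟨[], List.Sublist.refl _, trivial, hm⟩
  | cons e es ih =>
    rw [legalFrom_cons] at h
    -- Moving may have served the request earlier than before; its remaining events are dropped.
    by_cases hd : st' e.idx = .delivered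
    · have hm' : MovedBy σ φ (e.apply σ path st) st' := by
        intro j
        by_cases hj : e.idx = j
        · subst hj; exact .inl hd
        · rw [Event.apply_of_ne hj]; exact hm j
      obtain ⟨es', h1, h2, h3⟩ := ih h.2 hm'
      exact ⟨es', h1.cons _, h2, h3⟩
    · have hi : st' e.idx = (st e.idx).map φ := by
        rcases hm e.idx with h' | h' | ⟨h', -⟩
        · exact absurd h' hd
        · exact h'
        · exact absurd h.1.idx_lt (not_lt.2 h')
      have hm' : MovedBy σ φ (e.apply σ path st) (e.apply σ (φ ∘ path) st') := by
        intro j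
        by_cases hj : e.idx = j
        · subst hj
          simp only [Event.apply, Function.update_self, Function.comp]
          by_cases hb : e.isLoad = true
          · simp [hb, Status.map]
          · simp only [hb]
            -- A parking place that is moved onto the destination turns the parking into a delivery.
            by_cases h1 : ∃ r, σ[e.idx]? = some r ∧ φ (path e.time) = r.dst
            · left; simp [h1]
            · right; left
              have h2 : ¬∃ r, σ[e.idx]? = some r ∧ path e.time = r.dst := by
                rintro ⟨r, hr, hp⟩
                exact h1 ⟨r, hr, by rw [hp, (hφ r (List.mem_of_getElem? hr)).2]⟩
              simp [h1, h2, Status.map]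
        · rw [Event.apply_of_ne hj, Event.apply_of_ne hj]; exact hm j
      obtain ⟨es', h1, h2, h3⟩ := ih h.2 hm'
      refine ⟨e :: es', h1.cons_cons _, ⟨?_, h2⟩, h3⟩
      obtain ⟨r, hr, hl, hu⟩ := h.1
      refine ⟨r, hr, fun hb => ⟨?_, ?_⟩, fun hb => ?_⟩
      · have := (hl hb).1
        rw [hi]
        cases hs : st e.idx with
        | waiting =>
          rw [hs] at this
          have this : r.src = path e.time := by simpa [Status.spot] using this
          simp [Status.map, Status.spot, ← this, (hφ r (List.mem_of_getElem? hr)).1]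
        | carried => simp [hs, Status.spot] at this
        | parked y =>
          rw [hs] at this
          have this : y = path e.time := by simpa [Status.spot] using this
          simp [Status.map, Status.spot, this]
        | delivered => simp [hs, Status.spot] at this
      · refine lt_of_le_of_lt (Set.encard_le_encard ?_) (hl hb).2
        intro j hj
        have hj : st' j = .carried := hj
        rcases hm j with h' | h' | ⟨-, h'⟩
        · rw [h'] at hj; simp at hj
        · exact Status.map_eq_carried.1 (h' ▸ hj)
        · show st j = _
          rw [← h', hj]
      · rw [hi, hu hb]; rfl

end Tours

/-! ### Existence of shortest schedules on the half-line -/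

section HalfLine

theorem geodesicSpace_halfLine : GeodesicSpace ℝ≥0 := by
  intro x y
  have hval : ∀ s ∈ Set.Icc 0 (dist x y),
      ((Real.toNNReal (x + (if x ≤ y then s else -s)) : ℝ≥0) : ℝ) =
        x + (if x ≤ y then s else -s) := by
    intro s hs
    refine Real.coe_toNNReal _ ?_
    split_ifs with hxy
    · exact add_nonneg x.2 hs.1
    · have h2 := hs.2
      have hxy' : (y : ℝ) < x := by exact_mod_cast not_le.1 hxy
      rw [NNReal.dist_eq, abs_of_pos (by linarith)] at h2
      linarith [y.2]
  refine ⟨fun s => Real.toNNReal (x + (if x ≤ y then s else -s)), by simp, ?_, ?_⟩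
  · apply NNReal.coe_injective
    simp only
    rw [hval _ ⟨dist_nonneg, le_rfl⟩, NNReal.dist_eq]
    split_ifs with hxy
    · have hxy' : (x : ℝ) ≤ y := by exact_mod_cast hxy
      rw [abs_of_nonpos (by linarith)]; ring
    · have hxy' : (y : ℝ) < x := by exact_mod_cast not_le.1 hxy
      rw [abs_of_pos (by linarith)]; ring
  · intro s hs t ht
    rw [NNReal.dist_eq, hval s hs, hval t ht]
    split_ifs
    · congr 1; ring
    · rw [abs_sub_comm]; congr 1; ring

variable {x : ℝ≥0} {l : List ℝ≥0}

theorem tour_map_le {φ : ℝ≥0 → ℝ≥0} (W : Set ℝ≥0)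
    (hφ : ∀ y ∈ W, ∀ z ∈ W, dist (φ y) (φ z) ≤ dist y z) (hx : x ∈ W) (hl : ∀ y ∈ l, y ∈ W) :
    tour (φ x) (l.map φ) ≤ tour x l := by
  induction l generalizing x with
  | nil => exact le_rfl
  | cons y l ih =>
    exact add_le_add (hφ x hx y (hl y (by simp)))
      (ih (hl y (by simp)) fun z hz => hl z (by simp [hz]))

/-- Two competing moves are averaged: if no single leg grows on weighted average, neither does the
tour, so one of the moves is harmless. -/
theorem tour_map_add_le {φ ψ : ℝ≥0 → ℝ≥0} {a b : ℝ} (W : Set ℝ≥0)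
    (hφ : ∀ y ∈ W, ∀ z ∈ W,
      a * dist (φ y) (φ z) + b * dist (ψ y) (ψ z) ≤ (a + b) * dist y z)
    (hx : x ∈ W) (hl : ∀ y ∈ l, y ∈ W) :
    a * tour (φ x) (l.map φ) + b * tour (ψ x) (l.map ψ) ≤ (a + b) * tour x l := by
  induction l generalizing x with
  | nil => simp
  | cons y l ih =>
    have h1 := hφ x hx y (hl y (by simp))
    have h2 := ih (hl y (by simp)) fun z hz => hl z (by simp [hz])
    simp only [List.map_cons, tour_cons]
    linarith

/-- Moving one point of a tour to one of its neighbours does not make the tour longer. -/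
theorem exists_moved_tour {P : Finset ℝ≥0} (h0 : 0 ∈ P) (hx : x ∈ P) (hl : ∃ y ∈ l, y ∉ P) :
    ∃ φ : ℝ≥0 → ℝ≥0, (∀ y ∈ P, φ y = y) ∧ tour x (l.map φ) ≤ tour x l ∧
      ((l.map φ).toFinset \ P).card < (l.toFinset \ P).card := by
  obtain ⟨v, hvl, hvP⟩ := hl
  set W : Finset ℝ≥0 := P ∪ l.toFinset with hW
  set φ : ℝ≥0 → ℝ≥0 → ℝ≥0 := fun a => Function.update id v a with hφ
  have hφv : ∀ a, φ a v = a := fun a => by simp [hφ]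
  have hφne : ∀ a y, y ≠ v → φ a y = y := fun a y h => by simp [hφ, h]
  have hφP : ∀ a, ∀ y ∈ P, φ a y = y := fun a y hy =>
    hφne a y fun h => hvP (h ▸ hy)
  have hlW : ∀ y ∈ l, y ∈ (W : Set ℝ≥0) := fun y hy => by simp [hW, hy]
  have hxW : x ∈ (W : Set ℝ≥0) := by simp [hW, hx]
  -- All occurrences of v disappear and no position outside W is created, so the number of stops
  -- outside P drops.
  have hcard : ∀ a ∈ W, a ≠ v → ((l.map (φ a)).toFinset \ P).card < (l.toFinset \ P).card := by
    intro a ha hav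
    have hsub : (l.map (φ a)).toFinset \ P ⊆ (l.toFinset \ P).erase v := by
      intro y hy
      simp only [Finset.mem_sdiff, List.mem_toFinset, List.mem_map] at hy
      obtain ⟨⟨z, hz, rfl⟩, hyP⟩ := hy
      simp only [Finset.mem_erase, Finset.mem_sdiff, List.mem_toFinset]
      by_cases hzv : z = v
      · subst hzv
        rw [hφv] at hyP ⊢
        refine ⟨hav, ?_, hyP⟩
        simpa [hW, hyP] using ha
      · rw [hφne a z hzv] at hyP ⊢
        exact ⟨hzv, hz, hyP⟩
    refine (Finset.card_le_card hsub).trans_lt (Finset.card_erase_lt_of_mem ?_)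
    simp [hvl, hvP]
  have hv0 : 0 < v := pos_iff_ne_zero.2 fun h => hvP (h ▸ h0)
  -- A left neighbour exists because 0 ∈ P and v > 0.
  obtain ⟨a, ha, hamax⟩ := (W.filter (· < v)).exists_max_image id ⟨0, by simp [hW, h0, hv0]⟩
  obtain ⟨haW, hav⟩ := Finset.mem_filter.1 ha
  have hamax : ∀ y ∈ W, y < v → y ≤ a := fun y hy hyv => hamax y (by simp [hy, hyv])
  have hav' : (a : ℝ) < v := by exact_mod_cast hav
  by_cases hb : (W.filter (v < ·)).Nonempty
  · obtain ⟨b, hb, hbmin⟩ := (W.filter (v < ·)).exists_min_image id hb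
    obtain ⟨hbW, hvb⟩ := Finset.mem_filter.1 hb
    have hbmin : ∀ y ∈ W, v < y → b ≤ y := fun y hy hyv => hbmin y (by simp [hy, hyv])
    have hvb' : (v : ℝ) < b := by exact_mod_cast hvb
    -- No position of W except v lies strictly between a and b. So the distance to z is affine on
    -- [a, b], and the weights express v as a combination of a and b.
    have hsym : ∀ z ∈ W, z ≠ v →
        ((b : ℝ) - v) * dist a z + ((v : ℝ) - a) * dist b z ≤ ((b : ℝ) - v + (v - a)) * dist v z := by
      intro z hz hzv
      simp only [NNReal.dist_eq]
      rcases lt_or_gt_of_ne hzv with h | h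
      · have h1 : (z : ℝ) ≤ a := by exact_mod_cast hamax z hz h
        rw [abs_of_nonneg (by linarith), abs_of_nonneg (by linarith), abs_of_nonneg (by linarith)]
        exact le_of_eq (by ring)
      · have h1 : (b : ℝ) ≤ z := by exact_mod_cast hbmin z hz h
        rw [abs_of_nonpos (by linarith), abs_of_nonpos (by linarith), abs_of_nonpos (by linarith)]
        exact le_of_eq (by ring)
    have hpair : ∀ y ∈ (W : Set ℝ≥0), ∀ z ∈ (W : Set ℝ≥0),
        ((b : ℝ) - v) * dist (φ a y) (φ a z) + ((v : ℝ) - a) * dist (φ b y) (φ b z) ≤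
          ((b : ℝ) - v + (v - a)) * dist y z := by
      intro y hy z hz
      by_cases hyv : y = v <;> by_cases hzv : z = v
      · subst hyv; subst hzv; simp
      · subst hyv
        rw [hφv, hφv, hφne _ _ hzv, hφne _ _ hzv]
        exact hsym z hz hzv
      · subst hzv
        rw [hφv, hφv, hφne _ _ hyv, hφne _ _ hyv, dist_comm y a, dist_comm y b, dist_comm y z]
        exact hsym y hy hyv
      · rw [hφne _ _ hyv, hφne _ _ hzv, hφne _ _ hyv, hφne _ _ hzv]
        exact le_of_eq (by ring)
    have hsum := tour_map_add_le (W : Set ℝ≥0) hpair hxW hlW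
    rw [hφP a x hx, hφP b x hx] at hsum
    rcases le_or_gt (tour x (l.map (φ a))) (tour x l) with h | h
    · exact ⟨φ a, hφP a, h, hcard a haW hav.ne⟩
    · refine ⟨φ b, hφP b, ?_, hcard b hbW hvb.ne'⟩
      by_contra hcon
      have h1 := mul_lt_mul_of_pos_left h (show (0 : ℝ) < b - v by linarith)
      have h2 := mul_lt_mul_of_pos_left (not_le.1 hcon) (show (0 : ℝ) < v - a by linarith)
      linarith
  -- Without a right neighbour, v is the farthest point, and pulling it back shortens every leg that
  -- reaches it.
  · have hle : ∀ y ∈ W, y ≤ v := fun y hy => by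
      by_contra hcon
      exact hb ⟨y, by simp [hy, not_le.1 hcon]⟩
    have hsym : ∀ z ∈ W, z ≠ v → dist a z ≤ dist v z := by
      intro z hz hzv
      have h1 : (z : ℝ) ≤ a := by exact_mod_cast hamax z hz (lt_of_le_of_ne (hle z hz) hzv)
      simp only [NNReal.dist_eq]
      rw [abs_of_nonneg (by linarith), abs_of_nonneg (by linarith)]
      linarith
    have hpair : ∀ y ∈ (W : Set ℝ≥0), ∀ z ∈ (W : Set ℝ≥0), dist (φ a y) (φ a z) ≤ dist y z := by
      intro y hy z hz
      by_cases hyv : y = v <;> by_cases hzv : z = v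
      · subst hyv; subst hzv; simp
      · subst hyv
        rw [hφv, hφne _ _ hzv]
        exact hsym z hz hzv
      · subst hzv
        rw [hφv, hφne _ _ hyv, dist_comm y a, dist_comm y z]
        exact hsym y hy hyv
      · rw [hφne _ _ hyv, hφne _ _ hzv]
    have := tour_map_le (W : Set ℝ≥0) hpair hxW hlW
    rw [hφP a x hx] at this
    exact ⟨φ a, hφP a, this, hcard a haW hav.ne⟩

variable {σ : List (Request ℝ≥0)} {c : ℕ∞} {st : ℕ → Status ℝ≥0} {o : ℝ≥0}

/-- All events can be moved to a finite set of points that contains the relevant positions. -/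
theorem LegalFrom.exists_discrete {P : Finset ℝ≥0} (h0 : 0 ∈ P) (hx : x ∈ P)
    (hσ : ∀ r ∈ σ, r.src ∈ P ∧ r.dst ∈ P)
    (hst : ∀ j < σ.length, ∀ y, st j = .parked y → y ∈ P) {tl : List ℝ≥0} (htl : ∀ y ∈ tl, y ∈ P)
    {path : ℝ → ℝ≥0} {es : List Event} (h : LegalFrom σ c path st es) :
    ∃ (path' : ℝ → ℝ≥0) (es' : List Event), LegalFrom σ c path' st es' ∧ es'.Sublist es ∧
      (∀ j, statusAfter σ path es st j = .delivered →
        statusAfter σ path' es' st j = .delivered) ∧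
      (∀ e ∈ es', path' e.time ∈ P) ∧
      tour x ((es'.map fun e => path' e.time) ++ tl) ≤
        tour x ((es.map fun e => path e.time) ++ tl) := by
  induction hn : (((es.map fun e => path e.time) ++ tl).toFinset \ P).card using
    Nat.strong_induction_on generalizing path es with
  | _ n ih =>
    subst hn
    by_cases hP : ∃ y ∈ (es.map fun e => path e.time) ++ tl, y ∉ P
    · obtain ⟨φ, hφP, hφt, hφc⟩ := exists_moved_tour h0 hx hP
      have hm : MovedBy σ φ st st := by
        intro j
        rcases lt_or_ge j σ.length with hj | hj
        · right; left
          cases hs : st j with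
          | parked y => simp [Status.map, hφP y (hst j hj y hs)]
          | _ => rfl
        · exact .inr (.inr ⟨hj, rfl⟩)
      obtain ⟨es₁, hsub, hleg, hm₁⟩ := h.exists_moved
        (fun r hr => ⟨hφP _ (hσ r hr).1, hφP _ (hσ r hr).2⟩) hm
      have htlφ : tl.map φ = tl := by
        conv_rhs => rw [← List.map_id tl]
        exact List.map_congr_left fun y hy => hφP y (htl y hy)
      have hsub' : ((es₁.map fun e => (φ ∘ path) e.time) ++ tl).Sublist
          (((es.map fun e => path e.time) ++ tl).map φ) := by
        rw [List.map_append, htlφ, List.map_map]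
        exact (hsub.map _).append (List.Sublist.refl _)
      have hlt : (((es₁.map fun e => (φ ∘ path) e.time) ++ tl).toFinset \ P).card <
          (((es.map fun e => path e.time) ++ tl).toFinset \ P).card := by
        refine lt_of_le_of_lt (Finset.card_le_card (Finset.sdiff_subset_sdiff ?_ le_rfl)) hφc
        intro y hy
        rw [List.mem_toFinset] at hy ⊢
        exact hsub'.subset hy
      obtain ⟨path', es', h1, h2, h3, h4, h5⟩ := ih _ hlt hleg rfl
      exact ⟨path', es', h1, h2.trans hsub, fun j hj => h3 j (hm₁.delivered hj), h4,
        h5.trans ((tour_le_of_sublist hsub' x).trans hφt)⟩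
    · push Not at hP
      exact ⟨path, es, h, List.Sublist.refl _, fun _ h => h,
        fun e he => hP _ (List.mem_append_left _ (List.mem_map_of_mem he)), le_rfl⟩

/-- The positions that matter for a given situation are finitely many. -/
theorem exists_relevant_positions (σ : List (Request ℝ≥0)) (st : ℕ → Status ℝ≥0) (x o : ℝ≥0) :
    ∃ P : Finset ℝ≥0, 0 ∈ P ∧ x ∈ P ∧ o ∈ P ∧ (∀ r ∈ σ, r.src ∈ P ∧ r.dst ∈ P) ∧
      ∀ j < σ.length, ∀ y, st j = .parked y → y ∈ P := by
  classical
  refine ⟨{0, x, o} ∪ (σ.map Request.src).toFinset ∪ (σ.map Request.dst).toFinset ∪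
    (Finset.range σ.length).image (fun j => match st j with | .parked y => y | _ => 0),
    by simp, by simp, by simp, fun r hr => ⟨?_, ?_⟩, fun j hj y hy => ?_⟩
  · have : ∃ a ∈ σ, a.src = r.src := ⟨r, hr, rfl⟩
    simp [this]
  · have : ∃ a ∈ σ, a.dst = r.dst := ⟨r, hr, rfl⟩
    simp [this]
  · refine Finset.mem_union_right _ (Finset.mem_image.2 ⟨j, by simpa using hj, ?_⟩)
    simp [hy]

/-- Among the schedules that serve the requests in `J`, concern only requests in `I` and possibly
return to `o`, there is a shortest one. -/
theorem exists_shortest (I J : Set ℕ) {tl : List ℝ≥0} (htl : tl = [] ∨ tl = [o])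
    {Q : Schedule ℝ≥0 → Prop}
    (hQ : ∀ S : Schedule ℝ≥0, Q S ↔ S.Valid σ c x st ∧ (∀ e ∈ S.events, e.idx ∈ I) ∧
      (∀ j ∈ J, statusAfter σ S.path S.events st j = .delivered) ∧ (tl = [o] → S.path S.dur = o))
    (hne : ∃ S, Q S) : ∃ S, Schedule.IsShortest Q S := by
  obtain ⟨P, h0, hx, ho, hσ, hst⟩ := exists_relevant_positions σ st x o
  have htlP : ∀ y ∈ tl, y ∈ P := by
    rcases htl with rfl | rfl
    · simp
    · simpa using ho
  set D : Set ℝ := (AddSubmonoid.closure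
    ((fun p : ℝ≥0 × ℝ≥0 => dist p.1 p.2) '' (P : Set ℝ≥0) ×ˢ (P : Set ℝ≥0)) : Set ℝ) with hD
  -- Sums of finitely many nonnegative reals have no infinite descending chain, so a minimal tour
  -- length exists.
  have hPWO : D.IsPWO := by
    refine Set.IsPWO.addSubmonoid_closure ?_ ?_
    · rintro d ⟨p, -, rfl⟩; exact dist_nonneg
    · exact ((P.finite_toSet.prod P.finite_toSet).image _).isPWO
  -- Every schedule can be replaced by one that is no longer and whose duration lies in D;
  -- minimising over D is therefore enough.
  have key : ∀ S, Q S → ∃ S', Q S' ∧ S'.dur ≤ S.dur ∧ S'.dur ∈ D := by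
    intro S hS
    obtain ⟨hv, hI, hJ, he⟩ := (hQ S).1 hS
    obtain ⟨path', es', hleg, hsub, hdel, hpos, hlen⟩ :=
      hv.route.legal.exists_discrete h0 hx hσ hst htlP
    obtain ⟨S', h1, h2, h3, h4, h5⟩ := hleg.exists_schedule geodesicSpace_halfLine x htl
    refine ⟨S', (hQ S').2 ⟨h1, fun f hf => ?_, fun j hj => ?_, h3⟩, ?_, ?_⟩
    · obtain ⟨e, he, hef⟩ := h4 f hf
      rw [← hef]
      exact hI e (hsub.subset he)
    · rw [h5]; exact hdel j (hJ j hj)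
    · rw [h2]
      refine hlen.trans ?_
      have := tour_events_le hv.route.speed le_rfl hv.dur_nonneg hv.route.sorted
        fun e he => ⟨hv.route.nonneg e he, hv.events_le e he⟩
      rw [hv.route.start, sub_zero] at this
      refine le_trans (tour_le_of_sublist ?_ x) this
      refine (List.Sublist.refl _).append ?_
      rcases htl with rfl | rfl
      · simp
      · rw [he rfl]
    · rw [h2]
      refine tour_mem_closure hx fun y hy => ?_
      rcases List.mem_append.1 hy with hy | hy
      · obtain ⟨e, he, rfl⟩ := List.mem_map.1 hy
        exact hpos e he
      · exact htlP y hy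
  set E : Set ℝ := {d | d ∈ D ∧ ∃ S, Q S ∧ S.dur = d} with hE
  have hWF : E.IsWF := (hPWO.mono fun d hd => hd.1).isWF
  have hEne : E.Nonempty := by
    obtain ⟨S, hS⟩ := hne
    obtain ⟨S', hS', -, hd⟩ := key S hS
    exact ⟨_, hd, S', hS', rfl⟩
  obtain ⟨-, S, hS, hSd⟩ := hWF.min_mem hEne
  refine ⟨S, hS, fun T hT => ?_⟩
  obtain ⟨T', hT', hle, hd⟩ := key T hT
  rw [hSd]
  exact (hWF.min_le hEne ⟨hd, T', hT', rfl⟩).trans hle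

theorem nonempty_optimalSubschedules (o : ℝ≥0) (c : ℕ∞) :
    Nonempty (OptimalSubschedules o c) := by
  have hserve : ∀ (σ : List (Request ℝ≥0)) (x : ℝ≥0) (st : ℕ → Status ℝ≥0),
      ∃ S : Schedule ℝ≥0, (∃ S : Schedule ℝ≥0, S.Serves σ c x st) →
        Schedule.IsShortest (fun S => S.Serves σ c x st) S := by
    intro σ x st
    by_cases h : ∃ S : Schedule ℝ≥0, S.Serves σ c x st
    · obtain ⟨S, hS⟩ := exists_shortest (σ := σ) (c := c) (x := x) (st := st) (o := 0) Set.univ {j | j < σ.length} (tl := []) (.inl rfl)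
        (fun S => by simp [Schedule.Serves, Route.ServesAll]) h
      exact ⟨S, fun _ => hS⟩
    · exact ⟨Schedule.stay x 0, fun h' => absurd h' h⟩
  have hhome : ∀ (σ : List (Request ℝ≥0)) (x : ℝ≥0) (st : ℕ → Status ℝ≥0),
      ∃ S : Schedule ℝ≥0, (∃ S : Schedule ℝ≥0, S.ReturnsHome o σ c x st) →
        Schedule.IsShortest (fun S => S.ReturnsHome o σ c x st) S := by
    intro σ x st
    by_cases h : ∃ S : Schedule ℝ≥0, S.ReturnsHome o σ c x st
    · obtain ⟨S, hS⟩ := exists_shortest (σ := σ) (c := c) (x := x) (st := st) (o := o) {j | st j ≠ .waiting}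
        {j | j < σ.length ∧ st j ≠ .waiting} (tl := [o]) (.inr rfl)
        (fun S => by simp [Schedule.ReturnsHome]) h
      exact ⟨S, fun _ => hS⟩
    · exact ⟨Schedule.stay x 0, fun h' => absurd h' h⟩
  choose serve hserve using hserve
  choose home hhome using hhome
  exact ⟨⟨serve, home, fun σ x st _ => hserve σ x st, hhome⟩⟩

end HalfLine

/-! ### Competitive ratios -/

section Ratios

variable {M : Type*} [MetricSpace M] {c : ℕ∞} {o : M} {α β ε : ℝ}

theorem problemRatio_le (hM : GeodesicSpace M) (hc : 1 ≤ c) {A : Subroutines M}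
    (hA : A.Good ε o c) (hα : Admissible α β ε) (hG : ShortDetour o β ε) :
    problemRatio M o c ≤ ENNReal.ofReal (1 + α + 4 * ε) :=
  sInf_le ⟨_, by linarith [hα.four_le, hα.nonneg], ⟨_, A.isOnlineAlgorithm hA,
    A.isCompetitive hM hc hA hα hG⟩, rfl⟩

theorem OptimalSubschedules.lazy_spec (C : OptimalSubschedules o c) (hM : GeodesicSpace M)
    (hc : 1 ≤ c) (hα : Admissible α β 0) (hG : ShortDetour o β 0) :
    IsOnlineAlgorithm o c (DialARide.lazy α C) ∧
      algorithmRatio o c (DialARide.lazy α C) ≤ ENNReal.ofReal (1 + α) := by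
  have hA := C.good hM hc
  rw [C.lazy_eq]
  refine ⟨C.subroutines.isOnlineAlgorithm hA, sInf_le ⟨1 + α, by linarith [hα.four_le], ?_, rfl⟩⟩
  have := C.subroutines.isCompetitive hM hc hA hα hG
  rwa [mul_zero, add_zero] at this

theorem problemRatio_le_general (hM : GeodesicSpace M) (hc : 1 ≤ c) (o : M) :
    problemRatio M o c ≤ ENNReal.ofReal (1 + (1 / 2 + Real.sqrt (11 / 12))) := by
  refine ENNReal.le_of_forall_pos_le_add fun δ hδ _ => ?_
  have hδ' : (0 : ℝ) < δ := hδ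
  -- The loss in the ratio is 4ε ≤ δ, and 1/6 keeps the parameters admissible.
  have hε : 0 < min ((δ : ℝ) / 4) (1 / 6) := lt_min (by linarith) (by norm_num)
  obtain ⟨A, hA⟩ := exists_good_subroutines hM hc hε o
  refine (problemRatio_le hM hc hA (admissible_general hε.le (min_le_right _ _))
    (shortDetour o hε.le)).trans ?_
  refine ENNReal.ofReal_add_le.trans (add_le_add_right ?_ _)
  rw [← ENNReal.ofReal_coe_nnreal]
  exact ENNReal.ofReal_le_ofReal (by linarith [min_le_left ((δ : ℝ) / 4) (1 / 6)])

end Ratios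

end DialARide

end

open DialARide
theorem mainTheorem4 :
    (∀ (M : Type*) [MetricSpace M], GeodesicSpace M → ∀ (o : M) (c : ℕ∞), 1 ≤ c →
      problemRatio M o c ≤ ENNReal.ofReal (3 / 2 + Real.sqrt (11 / 12)) ∧
      ∀ C : OptimalSubschedules o c,
        IsOnlineAlgorithm o c (DialARide.lazy (1 / 2 + Real.sqrt (11 / 12)) C) ∧
        algorithmRatio o c (DialARide.lazy (1 / 2 + Real.sqrt (11 / 12)) C) ≤
          ENNReal.ofReal (3 / 2 + Real.sqrt (11 / 12))) ∧
    (∀ c : ℕ∞, 1 ≤ c →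
      problemRatio ℝ≥0 0 c ≤ ENNReal.ofReal (1 + (1 + Real.sqrt 3) / 2) ∧
      Nonempty (OptimalSubschedules (0 : ℝ≥0) c) ∧
      ∀ C : OptimalSubschedules (0 : ℝ≥0) c,
        IsOnlineAlgorithm (0 : ℝ≥0) c (DialARide.lazy ((1 + Real.sqrt 3) / 2) C) ∧
        algorithmRatio (0 : ℝ≥0) c (DialARide.lazy ((1 + Real.sqrt 3) / 2) C) ≤
          ENNReal.ofReal (1 + (1 + Real.sqrt 3) / 2)) := by
  refine ⟨fun M _ hM o c hc => ?_, fun c hc => ⟨?_, nonempty_optimalSubschedules 0 c, fun C =>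
    C.lazy_spec geodesicSpace_halfLine hc admissible_halfLine shortDetour_halfLine⟩⟩
  · have h : 3 / 2 + Real.sqrt (11 / 12) = 1 + (1 / 2 + Real.sqrt (11 / 12)) := by ring
    rw [h]
    exact ⟨problemRatio_le_general hM hc o, fun C => C.lazy_spec hM hc
      (admissible_general le_rfl (by norm_num)) (shortDetour o le_rfl)⟩
  -- Optimal sub-schedules exist here, so ε = 0 and no limit is needed.
  · obtain ⟨C⟩ := nonempty_optimalSubschedules 0 c
    have := problemRatio_le geodesicSpace_halfLine hc (C.good geodesicSpace_halfLine hc)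
      admissible_halfLine shortDetour_halfLine
    rwa [mul_zero, add_zero] at this
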